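/- Let $n>3$, let $J\subseteq\mathbb R$ be an open interval, let $(M^*,g^*)$ be a smooth Riemannian manifold of dimension $n-1$, and let $a:J\to(0,\infty)$ be a smooth non-constant function. Consider the generalized Robertson-Walker (GRW) space-time $J\times M^*$ with the Lorentzian metric $g=-dt^2+a(t)^2g^*$. Let $u=\partial_t$ be the comoving velocity, write $\dot f=u^k\nabla_k f=\partial_t f$ for scalars $f$, and let $R_{kl}$ and $R$ be the Ricci tensor and the scalar curvature of $g$. Then $u$ is an eigenvector of the Ricci tensor, $R_{kl}u^l=\xi u_k$ with $\xi=-R_{kl}u^ku^l$, and the following are equivalent: 1. the Ricci tensor belongs to Gray's subspace $\mathcal I$ (Sinyukov condition), i.e. $\nabla_jR_{kl}=a_jg_{kl}+b_kg_{jl}+b_lg_{jk}$ with $a_j=\frac{n}{(n-1)(n+2)}\nabla_jR$ and $b_j=\frac{n-2}{2(n-1)(n+2)}\nabla_jR$; 2. the space-time is a perfect fluid, i.e. $R_{kl}=A\,g_{kl}+B\,v_kv_l$ for some smooth scalar fields $A,B$ and some smooth vector field $v$ with $v_kv^k=-1$, and $(n+2)\dot\xi=2\dot R$. If these conditions hold,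 then $R$ and $\xi$ depend only on $t$, and there are constants $\alpha,\beta\in\mathbb R$ such that for all $t\in J$ $$R(t)=\alpha-\beta\,\frac{n+2}{n-2}\,a(t)^2,\qquad \xi(t)=\frac{\alpha}{n}-\beta\,\frac{2}{n-2}\,a(t)^2 .$$ -/

import Mathlib

open scoped Manifold ContDiff Topology
open Set Module

noncomputable section

namespace GRW

/-! ### Curvature of a metric given by its component matrix in linear coordinates -/

section Coordinates

variable {ι E : Type*} [Fintype ι] [DecidableEq ι] [NormedAddCommGroup E] [NormedSpace ℝ E]

/-- The partial derivative `∂ᵢ f` at `y`, for the linear coordinates of the basis `b`. -/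
def partialDeriv (b : Basis ι ℝ E) (i : ι) (f : E → ℝ) (y : E) : ℝ :=
  fderiv ℝ f y (b i)

/-- Christoffel symbols `Γᵏᵢⱼ = ½ gᵏˡ (∂ᵢ gⱼₗ + ∂ⱼ gᵢₗ - ∂ₗ gᵢⱼ)`. -/
def christoffel (b : Basis ι ℝ E) (G : E → Matrix ι ι ℝ) (k i j : ι) (y : E) : ℝ :=
  (1 / 2 : ℝ) * ∑ l, (G y)⁻¹ k l *
    (partialDeriv b i (fun z => G z j l) y + partialDeriv b j (fun z => G z i l) y
      - partialDeriv b l (fun z => G z i j) y)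

/-- Ricci tensor `Rᵢⱼ = ∂ₖ Γᵏᵢⱼ - ∂ⱼ Γᵏᵢₖ + Γᵏₖₗ Γˡᵢⱼ - Γᵏⱼₗ Γˡᵢₖ`
(positive on round spheres). -/
def ricciCoord (b : Basis ι ℝ E) (G : E → Matrix ι ι ℝ) (i j : ι) (y : E) : ℝ :=
  ∑ k, (partialDeriv b k (christoffel b G k i j) y - partialDeriv b j (christoffel b G k i k) y)
    + ∑ k, ∑ l, (christoffel b G k k l y * christoffel b G l i j y
        - christoffel b G k j l y * christoffel b G l i k y)

/-- Scalar curvature `R = gⁱʲ Rᵢⱼ`. -/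
def scalarCoord (b : Basis ι ℝ E) (G : E → Matrix ι ι ℝ) (y : E) : ℝ :=
  ∑ i, ∑ j, (G y)⁻¹ i j * ricciCoord b G i j y

/-- Covariant derivative of the Ricci tensor,
`∇ⱼ Rₖₗ = ∂ⱼ Rₖₗ - Γᵐⱼₖ Rₘₗ - Γᵐⱼₗ Rₖₘ`. -/
def nablaRicciCoord (b : Basis ι ℝ E) (G : E → Matrix ι ι ℝ) (j k l : ι) (y : E) : ℝ :=
  partialDeriv b j (ricciCoord b G k l) y
    - ∑ m, christoffel b G m j k y * ricciCoord b G m l y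
    - ∑ m, christoffel b G m j l y * ricciCoord b G k m y

/-- Gray's coefficient `aⱼ = n / ((n - 1) (n + 2)) ∇ⱼ R`, where `n` is the dimension. -/
def grayA (b : Basis ι ℝ E) (G : E → Matrix ι ι ℝ) (j : ι) (y : E) : ℝ :=
  (Fintype.card ι : ℝ) / (((Fintype.card ι : ℝ) - 1) * ((Fintype.card ι : ℝ) + 2))
    * partialDeriv b j (scalarCoord b G) y

/-- Gray's coefficient `bⱼ = (n - 2) / (2 (n - 1) (n + 2)) ∇ⱼ R`, where `n` is the dimension. -/
def grayB (b : Basis ι ℝ E) (G : E → Matrix ι ι ℝ) (j : ι) (y : E) : ℝ :=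
  ((Fintype.card ι : ℝ) - 2) / (2 * ((Fintype.card ι : ℝ) - 1) * ((Fintype.card ι : ℝ) + 2))
    * partialDeriv b j (scalarCoord b G) y

/-- The trace-free part of the gradient of the Ricci tensor in Gray's decomposition,
`∇ⱼ Rₖₗ - (aⱼ gₖₗ + bₖ gⱼₗ + bₗ gⱼₖ)`. -/
def grayTraceFree (b : Basis ι ℝ E) (G : E → Matrix ι ι ℝ) (j k l : ι) (y : E) : ℝ :=
  nablaRicciCoord b G j k l y
    - (grayA b G j y * G y k l + grayB b G k y * G y j l + grayB b G l y * G y j k)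

end Coordinates

/-! ### Curvature of a metric on a manifold, read in the charts of the atlas -/

section Manifold

variable {ι E H M : Type*} [Fintype ι] [DecidableEq ι]
  [NormedAddCommGroup E] [NormedSpace ℝ E] [TopologicalSpace H]
  [TopologicalSpace M] [ChartedSpace H M]

/-- A field of bilinear forms on the tangent spaces of `M`. -/
abbrev BilinField (I : ModelWithCorners ℝ E H) (M : Type*) [TopologicalSpace M]
    [ChartedSpace H M] :=
  ∀ p : M, TangentSpace I p →L[ℝ] TangentSpace I p →L[ℝ] ℝ

/-- The components `g(∂ᵢ, ∂ⱼ)` of `g` in the chart `e`, as functions of the coordinates. -/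
def metricInChart (b : Basis ι ℝ E) (I : ModelWithCorners ℝ E H) (g : BilinField I M)
    (e : OpenPartialHomeomorph M H) (y : E) : Matrix ι ι ℝ :=
  fun i j => g ((e.extend I).symm y)
    (mfderiv 𝓘(ℝ, E) I (e.extend I).symm y (b i))
    (mfderiv 𝓘(ℝ, E) I (e.extend I).symm y (b j))

/-- The scalar curvature at `p`, computed in the chart `e`. -/
def scalarCurvature (b : Basis ι ℝ E) (I : ModelWithCorners ℝ E H) (g : BilinField I M)
    (e : OpenPartialHomeomorph M H) (p : M) : ℝ :=
  scalarCoord b (metricInChart b I g e) (e.extend I p)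

/-- The Ricci tensor `Ric(v, w) = Rᵢⱼ vⁱ wʲ` at `p`, computed in the chart `e`. -/
def ricciTensor (b : Basis ι ℝ E) (I : ModelWithCorners ℝ E H) (g : BilinField I M)
    (e : OpenPartialHomeomorph M H) (p : M) (v w : TangentSpace I p) : ℝ :=
  ∑ i, ∑ j, ricciCoord b (metricInChart b I g e) i j (e.extend I p)
    * b.repr (mfderiv I 𝓘(ℝ, E) (e.extend I) p v) i
    * b.repr (mfderiv I 𝓘(ℝ, E) (e.extend I) p w) j

/-- The Ricci tensor of `g` on the open set `U` belongs to Gray's subspace `𝓘`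
(Sinyukov condition): the trace-free part of `∇ Ric` vanishes on `U`, i.e.
`∇ⱼ Rₖₗ = aⱼ gₖₗ + bₖ gⱼₗ + bₗ gⱼₖ` in the charts of the atlas. -/
def InGrayI (b : Basis ι ℝ E) (I : ModelWithCorners ℝ E H) (g : BilinField I M)
    (U : Set M) : Prop :=
  ∀ e ∈ atlas H M, ∀ p ∈ e.source ∩ U, ∀ j k l : ι,
    grayTraceFree b (metricInChart b I g e) j k l (e.extend I p) = 0

/-- `g` is a perfect fluid on the open set `U`: `Rₖₗ = A gₖₗ + B vₖ vₗ` with smooth scalar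
fields `A`, `B` and a smooth time-like unit vector field `v`. -/
def IsPerfectFluid (b : Basis ι ℝ E) (I : ModelWithCorners ℝ E H) [IsManifold I ∞ M]
    (g : BilinField I M) (U : Set M) : Prop :=
  ∃ (A B : M → ℝ) (v : ∀ p : M, TangentSpace I p),
    ContMDiffOn I 𝓘(ℝ, ℝ) ∞ A U ∧ ContMDiffOn I 𝓘(ℝ, ℝ) ∞ B U ∧
    ContMDiffOn I I.tangent ∞ (fun p => (⟨p, v p⟩ : TangentBundle I M)) U ∧
    (∀ p ∈ U, g p (v p) (v p) = -1) ∧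
    ∀ e ∈ atlas H M, ∀ p ∈ e.source ∩ U, ∀ w z : TangentSpace I p,
      ricciTensor b I g e p w z = A p * g p w z + B p * g p (v p) w * g p (v p) z

end Manifold

/-! ### Generalized Robertson-Walker space-times -/

section Spacetime

/-- The model space of the fibre (dimension `d`). -/
abbrev Fib (d : ℕ) := EuclideanSpace ℝ (Fin d)

/-- The model of the product manifold `ℝ × M`. -/
abbrev stModel (d : ℕ) :
    ModelWithCorners ℝ (ℝ × Fib d) (ModelProd ℝ (Fib d)) :=
  𝓘(ℝ, ℝ).prod 𝓘(ℝ, Fib d)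

/-- The standard basis of `ℝ × ℝᵈ`: time first, then the spatial directions. -/
def stBasis (d : ℕ) : Basis (Unit ⊕ Fin d) ℝ (ℝ × Fib d) :=
  (Basis.singleton Unit ℝ).prod (EuclideanSpace.basisFun (Fin d) ℝ).toBasis

variable {d : ℕ} {M : Type*} [TopologicalSpace M] [ChartedSpace (Fib d) M]
  [IsManifold 𝓘(ℝ, Fib d) ∞ M]

/-- Smooth Riemannian metrics on the fibre. -/
abbrev FibreMetric (d : ℕ) (M : Type*) [TopologicalSpace M] [ChartedSpace (Fib d) M]
    [IsManifold 𝓘(ℝ, Fib d) ∞ M] :=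
  Bundle.ContMDiffRiemannianMetric 𝓘(ℝ, Fib d) ∞ (Fib d)
    (fun x : M => TangentSpace 𝓘(ℝ, Fib d) x)

/-- The warped product metric `-dt² + a(t)² g*` at the points `(t, x)` of `ℝ × M`. -/
def grwMetric (a : ℝ → ℝ) (gs : FibreMetric d M) : BilinField (stModel d) (ℝ × M) :=
  fun p =>
    let dt : ℝ × Fib d →L[ℝ] ℝ := ContinuousLinearMap.fst ℝ ℝ (Fib d)
    let pr : ℝ × Fib d →L[ℝ] Fib d := ContinuousLinearMap.snd ℝ ℝ (Fib d)
    let gx : Fib d →L[ℝ] Fib d →L[ℝ] ℝ := gs.inner p.2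
    (-((ContinuousLinearMap.mul ℝ ℝ).bilinearComp dt dt) + (a p.1 ^ 2) • gx.bilinearComp pr pr :
      ℝ × Fib d →L[ℝ] ℝ × Fib d →L[ℝ] ℝ)

theorem grwMetric_apply (a : ℝ → ℝ) (gs : FibreMetric d M) (p : ℝ × M)
    (τ σ : ℝ) (v w : Fib d) :
    grwMetric a gs p ((τ, v) : ℝ × Fib d) ((σ, w) : ℝ × Fib d) =
      -(τ * σ) + a p.1 ^ 2 * gs.inner p.2 v w := rfl

/-- The comoving velocity field `u = ∂ₜ`. -/
def comoving (p : ℝ × M) : TangentSpace (stModel d) p := ((1, 0) : ℝ × Fib d)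

/-- The scalar `ξ = - Ric(u, u)`: as `g(u, u) = -1`, the eigenvalue in `Ric(u, ·) = ξ g(u, ·)`. -/
def ricciEigenvalue (a : ℝ → ℝ) (gs : FibreMetric d M)
    (e : OpenPartialHomeomorph (ℝ × M) (ModelProd ℝ (Fib d))) (p : ℝ × M) : ℝ :=
  -ricciTensor (stBasis d) (stModel d) (grwMetric a gs) e p (comoving p) (comoving p)

/-- The scalar curvature of the space-time, computed in the chart `e`. -/
def scalarR (a : ℝ → ℝ) (gs : FibreMetric d M)
    (e : OpenPartialHomeomorph (ℝ × M) (ModelProd ℝ (Fib d))) (p : ℝ × M) : ℝ :=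
  scalarCurvature (stBasis d) (stModel d) (grwMetric a gs) e p

/-- The directional derivative `f˙ = uᵏ ∇ₖ f = ∂ₜ f` of a scalar. -/
def dot (f : ℝ × M → ℝ) (p : ℝ × M) : ℝ := deriv (fun s : ℝ => f (s, p.2)) p.1

end Spacetime

end GRW

end

/-! Write d = n - 1 for the dimension of the fibre and H = a'/a. Both conditions are equivalent to a
third one (`IsEinsteinSinyukov`): the fibre is Einstein with one constant c, and (n + 2) ξ' = 2 R'
on J.

In a product chart the metric is block diagonal with blocks -1 and a² g*. A direct computation gives
R_tt = -d a''/a, R_ti = 0 and R_ij = R*_ij + (a a'' + (d - 1) a'²) g*_ij. Hence ξ = d a''/a, and R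
depends on the fibre only through the term s/a², where s is the scalar curvature of g*.

From Sinyukov to Einstein: the component (t,t,t) is the equation for ξ'. The component (i,t,j)
contains R*_ij with coefficient -H and otherwise only multiples of g*_ij, so at a time t₀ with
a'(t₀) ≠ 0 it makes g* Einstein at each point. From perfect fluid to Einstein: u is an eigenvector
and v is not orthogonal to u, so the term B v v dies on spatial vectors and leaves R_ij = A g_ij. In
both cases the Einstein constant is global because (n + 2) ξ' = 2 R' at t₀ determines s
(`eq_of_deriv_warpedScalar_eq`); neither Schur's lemma nor connectedness of the fibre enters.

Conversely, over an Einstein fibre the Ricci tensor is visibly that of a perfect fluid with v = u.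
The Sinyukov identity is checked componentwise; the mixed components need the contracted Bianchi
identity R' - 2ξ' = 2H(nξ - R) (`deriv_warpedScalar_sub`). The same identity turns (n + 2) ξ' = 2 R'
into (nξ - R)' = 2H(nξ - R). So (n + 2) ξ - 2R and (nξ - R)/a² are constants, and solving for R and
ξ gives the stated formulas. -/

namespace GRW

/-! ### Smoothness of curvature components and the Levi-Civita identities. -/

section Coordinates

variable {ι E : Type*} [NormedAddCommGroup E] [NormedSpace ℝ E]

/-! ### Regularity of the curvature components -/

theorem partialDeriv_congr {b : Basis ι ℝ E} {i : ι} {f g : E → ℝ} {U : Set E} (hU : IsOpen U)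
    (h : EqOn f g U) {y : E} (hy : y ∈ U) : partialDeriv b i f y = partialDeriv b i g y := by
  unfold partialDeriv
  rw [Filter.EventuallyEq.fderiv_eq (Filter.eventuallyEq_of_mem (hU.mem_nhds hy) h)]

theorem contDiffOn_partialDeriv (b : Basis ι ℝ E) (i : ι) {f : E → ℝ} {U : Set E}
    (hU : IsOpen U) (hf : ContDiffOn ℝ ∞ f U) : ContDiffOn ℝ ∞ (partialDeriv b i f) U :=
  (hf.fderiv_of_isOpen hU (by simp)).clm_apply contDiffOn_const

variable [Fintype ι] [DecidableEq ι]

theorem contDiffOn_det {G : E → Matrix ι ι ℝ} {U : Set E}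
    (hG : ∀ i j, ContDiffOn ℝ ∞ (fun y => G y i j) U) :
    ContDiffOn ℝ ∞ (fun y => (G y).det) U := by
  simp only [Matrix.det_apply]
  exact ContDiffOn.sum fun σ _ => (contDiffOn_prod fun i _ => hG _ _).const_smul _

/-- Cramer's rule: an entry of the adjugate is again a determinant, with one row replaced by a
constant row. -/
theorem contDiffOn_inv_entry {G : E → Matrix ι ι ℝ} {U : Set E}
    (hG : ∀ i j, ContDiffOn ℝ ∞ (fun y => G y i j) U) (hdet : ∀ y ∈ U, IsUnit (G y).det)
    (i j : ι) : ContDiffOn ℝ ∞ (fun y => (G y)⁻¹ i j) U := by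
  simp only [Matrix.inv_def, Matrix.smul_apply, Matrix.adjugate_apply, Ring.inverse_eq_inv',
    smul_eq_mul]
  refine ((contDiffOn_det hG).inv fun y hy => (hdet y hy).ne_zero).mul
    (contDiffOn_det fun k l => ?_)
  simp only [Matrix.updateRow_apply]
  split_ifs
  · exact contDiffOn_const
  · exact hG k l

variable {b : Basis ι ℝ E} {G : E → Matrix ι ι ℝ} {U : Set E}

theorem contDiffOn_christoffel (hU : IsOpen U)
    (hG : ∀ i j, ContDiffOn ℝ ∞ (fun y => G y i j) U) (hdet : ∀ y ∈ U, IsUnit (G y).det)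
    (k i j : ι) : ContDiffOn ℝ ∞ (christoffel b G k i j) U := by
  have h : ∀ m p q, ContDiffOn ℝ ∞ (partialDeriv b m fun z => G z p q) U := fun m p q =>
    contDiffOn_partialDeriv b m hU (hG p q)
  exact contDiffOn_const.mul (ContDiffOn.sum fun l _ =>
    (contDiffOn_inv_entry hG hdet k l).mul (((h i j l).add (h j i l)).sub (h l i j)))

theorem contDiffOn_ricciCoord (hU : IsOpen U)
    (hG : ∀ i j, ContDiffOn ℝ ∞ (fun y => G y i j) U) (hdet : ∀ y ∈ U, IsUnit (G y).det)
    (i j : ι) : ContDiffOn ℝ ∞ (ricciCoord b G i j) U := by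
  have h := contDiffOn_christoffel (b := b) hU hG hdet
  exact (ContDiffOn.sum fun k _ => (contDiffOn_partialDeriv b k hU (h k i j)).sub
      (contDiffOn_partialDeriv b j hU (h k i k))).add
    (ContDiffOn.sum fun k _ => ContDiffOn.sum fun l _ =>
      ((h k k l).mul (h l i j)).sub ((h k j l).mul (h l i k)))

theorem contDiffOn_scalarCoord (hU : IsOpen U)
    (hG : ∀ i j, ContDiffOn ℝ ∞ (fun y => G y i j) U) (hdet : ∀ y ∈ U, IsUnit (G y).det) :
    ContDiffOn ℝ ∞ (scalarCoord b G) U :=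
  ContDiffOn.sum fun i _ => ContDiffOn.sum fun j _ =>
    (contDiffOn_inv_entry hG hdet i j).mul (contDiffOn_ricciCoord hU hG hdet i j)

/-! ### The Levi-Civita connection -/

theorem christoffel_symm (hU : IsOpen U) (hsymm : ∀ y ∈ U, (G y).IsSymm) (k i j : ι) {y : E}
    (hy : y ∈ U) : christoffel b G k i j y = christoffel b G k j i y := by
  unfold christoffel
  congr 1
  refine Finset.sum_congr rfl fun l _ => ?_
  rw [partialDeriv_congr hU (f := fun z => G z i j) (g := fun z => G z j i)
    (fun z hz => (hsymm z hz).apply j i) hy]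
  ring

/-- Lowering the upper index of the Christoffel symbols. -/
theorem sum_mul_christoffel {y : E} (hdet : IsUnit (G y).det) (m i j : ι) :
    ∑ k, G y m k * christoffel b G k i j y =
      (1 / 2 : ℝ) * (partialDeriv b i (fun z => G z j m) y + partialDeriv b j (fun z => G z i m) y
        - partialDeriv b m (fun z => G z i j) y) := by
  set c : ι → ℝ := fun l => partialDeriv b i (fun z => G z j l) y
    + partialDeriv b j (fun z => G z i l) y - partialDeriv b l (fun z => G z i j) y with hc
  have h : (fun k => christoffel b G k i j y) = (1 / 2 : ℝ) • ((G y)⁻¹.mulVec c) := by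
    ext k
    simp [christoffel, Matrix.mulVec, dotProduct, hc]
  have h2 : ∑ k, G y m k * christoffel b G k i j y
      = ((G y).mulVec fun k => christoffel b G k i j y) m := by
    simp [Matrix.mulVec, dotProduct]
  rw [h2, h, Matrix.mulVec_smul, Matrix.mulVec_mulVec, Matrix.mul_nonsing_inv _ hdet,
    Matrix.one_mulVec]
  simp [hc]

/-- The Levi-Civita connection is metric. -/
theorem partialDeriv_metric (hU : IsOpen U) (hsymm : ∀ y ∈ U, (G y).IsSymm)
    (hdet : ∀ y ∈ U, IsUnit (G y).det) (j k l : ι) {y : E} (hy : y ∈ U) :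
    partialDeriv b j (fun z => G z k l) y =
      ∑ m, christoffel b G m j k y * G y m l + ∑ m, christoffel b G m j l y * G y k m := by
  have h1 : ∑ m, christoffel b G m j k y * G y m l = ∑ m, G y l m * christoffel b G m j k y :=
    Finset.sum_congr rfl fun m _ => by rw [(hsymm y hy).apply l m, mul_comm]
  have h2 : ∑ m, christoffel b G m j l y * G y k m = ∑ m, G y k m * christoffel b G m j l y :=
    Finset.sum_congr rfl fun m _ => mul_comm _ _
  have hs : ∀ i p q, partialDeriv b i (fun z => G z p q) y = partialDeriv b i (fun z => G z q p) y :=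
    fun i p q => partialDeriv_congr hU (fun z hz => (hsymm z hz).apply q p) hy
  rw [h1, h2, sum_mul_christoffel (hdet y hy), sum_mul_christoffel (hdet y hy), hs j l k,
    hs k j l, hs l j k]
  ring

end Coordinates

/-! ### Product coordinates and the Christoffel symbols of a warped product. -/

section WarpedCoordinates

/-- The standard basis of the model space of the fibre. -/
noncomputable abbrev fibBasis (d : ℕ) : Basis (Fin d) ℝ (Fib d) :=
  (EuclideanSpace.basisFun (Fin d) ℝ).toBasis

variable {d : ℕ}

theorem stBasis_inl (u : Unit) : stBasis d (Sum.inl u) = ((1, 0) : ℝ × Fib d) := by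
  simp [stBasis, Basis.prod_apply]

theorem stBasis_inr (i : Fin d) : stBasis d (Sum.inr i) = ((0, fibBasis d i) : ℝ × Fib d) := by
  simp [stBasis, Basis.prod_apply]

theorem stBasis_repr_inl (q : ℝ × Fib d) (u : Unit) : (stBasis d).repr q (Sum.inl u) = q.1 := by
  simp [stBasis]

theorem stBasis_repr_inr (q : ℝ × Fib d) (i : Fin d) :
    (stBasis d).repr q (Sum.inr i) = (fibBasis d).repr q.2 i := by
  simp [stBasis]

/-! ### Partial derivatives on a product -/

theorem partialDeriv_inl (u : Unit) {f : ℝ × Fib d → ℝ} {t : ℝ} {x : Fib d}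
    (hf : DifferentiableAt ℝ f (t, x)) :
    partialDeriv (stBasis d) (Sum.inl u) f (t, x) = deriv (fun s => f (s, x)) t := by
  have h := hf.hasFDerivAt.comp_hasDerivAt t ((hasDerivAt_id t).prodMk (hasDerivAt_const t x))
  rw [partialDeriv, stBasis_inl]
  exact h.deriv.symm

theorem partialDeriv_inr (i : Fin d) {f : ℝ × Fib d → ℝ} {t : ℝ} {x : Fib d}
    (hf : DifferentiableAt ℝ f (t, x)) :
    partialDeriv (stBasis d) (Sum.inr i) f (t, x)
      = partialDeriv (fibBasis d) i (fun z => f (t, z)) x := by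
  have h := hf.hasFDerivAt.comp x ((hasFDerivAt_const t x).prodMk (hasFDerivAt_id x))
  rw [partialDeriv, stBasis_inr, partialDeriv]
  have h2 : fderiv ℝ (fun z => f (t, z)) x = _ := h.fderiv
  rw [h2]
  rfl

variable {J : Set ℝ} {V : Set (Fib d)} {f : ℝ × Fib d → ℝ} {φ : ℝ → ℝ} {ψ : Fib d → ℝ}
  {t : ℝ} {x : Fib d}

/-- The nonconstant metric, Christoffel and (over an Einstein fibre) Ricci components to be
differentiated are products of a function of time and a function on the fibre. This lemma and its
spatial twin differentiate them. -/
theorem partialDeriv_inl_of_eq_mul (u : Unit) (hJ : IsOpen J) (hV : IsOpen V)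
    (h : ∀ s ∈ J, ∀ z ∈ V, f (s, z) = φ s * ψ z) (ht : t ∈ J) (hx : x ∈ V)
    (hφ : DifferentiableAt ℝ φ t) (hψ : DifferentiableAt ℝ ψ x) :
    partialDeriv (stBasis d) (Sum.inl u) f (t, x) = deriv φ t * ψ x := by
  rw [partialDeriv_congr (hJ.prod hV) (g := fun y => φ y.1 * ψ y.2)
    (fun y hy => h y.1 hy.1 y.2 hy.2) ⟨ht, hx⟩, partialDeriv_inl]
  · simp
  · exact (hφ.comp (t, x) differentiableAt_fst).mul (hψ.comp (t, x) differentiableAt_snd)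

theorem partialDeriv_inr_of_eq_mul (i : Fin d) (hJ : IsOpen J) (hV : IsOpen V)
    (h : ∀ s ∈ J, ∀ z ∈ V, f (s, z) = φ s * ψ z) (ht : t ∈ J) (hx : x ∈ V)
    (hφ : DifferentiableAt ℝ φ t) (hψ : DifferentiableAt ℝ ψ x) :
    partialDeriv (stBasis d) (Sum.inr i) f (t, x) = φ t * partialDeriv (fibBasis d) i ψ x := by
  rw [partialDeriv_congr (hJ.prod hV) (g := fun y => φ y.1 * ψ y.2)
    (fun y hy => h y.1 hy.1 y.2 hy.2) ⟨ht, hx⟩, partialDeriv_inr]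
  · simp only [partialDeriv]
    rw [fderiv_const_mul hψ]
    simp
  · exact (hφ.comp (t, x) differentiableAt_fst).mul (hψ.comp (t, x) differentiableAt_snd)

theorem partialDeriv_eq_zero_of_eq_const (m : Unit ⊕ Fin d) (hJ : IsOpen J) (hV : IsOpen V) {c : ℝ}
    (h : ∀ s ∈ J, ∀ z ∈ V, f (s, z) = c) (ht : t ∈ J) (hx : x ∈ V) :
    partialDeriv (stBasis d) m f (t, x) = 0 := by
  rw [partialDeriv_congr (hJ.prod hV) (g := fun _ => c)
    (fun y hy => h y.1 hy.1 y.2 hy.2) ⟨ht, hx⟩]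
  simp [partialDeriv]

/-! ### The curvature of a warped product in product coordinates -/

/-- On `J × V` the matrix `G` is that of the warped product `-dt² + a(t)² Gs`. -/
structure IsWarpedProduct (J : Set ℝ) (a : ℝ → ℝ) (V : Set (Fib d))
    (Gs : Fib d → Matrix (Fin d) (Fin d) ℝ)
    (G : ℝ × Fib d → Matrix (Unit ⊕ Fin d) (Unit ⊕ Fin d) ℝ) : Prop where
  isOpen_base : IsOpen J
  isOpen_fibre : IsOpen V
  contDiffOn_scale : ContDiffOn ℝ ∞ a J
  scale_pos : ∀ t ∈ J, 0 < a t
  contDiffOn_fibre : ∀ i j, ContDiffOn ℝ ∞ (fun y => Gs y i j) V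
  isSymm_fibre : ∀ x ∈ V, (Gs x).IsSymm
  isUnit_det_fibre : ∀ x ∈ V, IsUnit (Gs x).det
  eq_fromBlocks : ∀ t ∈ J, ∀ x ∈ V, G (t, x) = Matrix.fromBlocks (-1) 0 0 (a t ^ 2 • Gs x)

namespace IsWarpedProduct

variable {a : ℝ → ℝ} {Gs : Fib d → Matrix (Fin d) (Fin d) ℝ}
  {G : ℝ × Fib d → Matrix (Unit ⊕ Fin d) (Unit ⊕ Fin d) ℝ}
  (h : IsWarpedProduct J a V Gs G)
include h

theorem contDiffOn_deriv : ContDiffOn ℝ ∞ (deriv a) J :=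
  h.contDiffOn_scale.deriv_of_isOpen h.isOpen_base (by simp)

theorem contDiffOn_deriv_deriv : ContDiffOn ℝ ∞ (deriv (deriv a)) J :=
  h.contDiffOn_deriv.deriv_of_isOpen h.isOpen_base (by simp)

theorem differentiableAt_of_base {F : Type*} [NormedAddCommGroup F] [NormedSpace ℝ F] {f : ℝ → F}
    (hf : ContDiffOn ℝ ∞ f J) (ht : t ∈ J) : DifferentiableAt ℝ f t :=
  (hf.contDiffAt (h.isOpen_base.mem_nhds ht)).differentiableAt (by simp)

theorem differentiableAt_of_fibre {f : Fib d → ℝ}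
    (hf : ContDiffOn ℝ ∞ f V) (hx : x ∈ V) : DifferentiableAt ℝ f x :=
  (hf.contDiffAt (h.isOpen_fibre.mem_nhds hx)).differentiableAt (by simp)

theorem hasDerivAt_scale (ht : t ∈ J) : HasDerivAt a (deriv a t) t :=
  (h.differentiableAt_of_base h.contDiffOn_scale ht).hasDerivAt

theorem hasDerivAt_deriv (ht : t ∈ J) : HasDerivAt (deriv a) (deriv (deriv a) t) t :=
  (h.differentiableAt_of_base h.contDiffOn_deriv ht).hasDerivAt

theorem hasDerivAt_deriv_deriv (ht : t ∈ J) :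
    HasDerivAt (deriv (deriv a)) (deriv (deriv (deriv a)) t) t :=
  (h.differentiableAt_of_base h.contDiffOn_deriv_deriv ht).hasDerivAt

theorem scale_ne_zero (ht : t ∈ J) : a t ≠ 0 := (h.scale_pos t ht).ne'

theorem inv_eq (ht : t ∈ J) (hx : x ∈ V) :
    (G (t, x))⁻¹ = Matrix.fromBlocks (-1) 0 0 ((a t ^ 2)⁻¹ • (Gs x)⁻¹) := by
  apply Matrix.inv_eq_right_inv
  have ha := h.scale_ne_zero ht
  rw [h.eq_fromBlocks t ht x hx, Matrix.fromBlocks_multiply]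
  simp [Matrix.mul_nonsing_inv _ (h.isUnit_det_fibre x hx), smul_smul, ha]

theorem sum_inv_mul (hx : x ∈ V) (k j : Fin d) :
    ∑ l, (Gs x)⁻¹ k l * Gs x j l = if k = j then 1 else 0 := by
  have h1 := congrFun (congrFun (Matrix.nonsing_inv_mul _ (h.isUnit_det_fibre x hx)) k) j
  rw [Matrix.mul_apply, Matrix.one_apply] at h1
  rw [← h1]
  exact Finset.sum_congr rfl fun l _ => by rw [(h.isSymm_fibre x hx).apply l j]

theorem partialDeriv_inl_inl (m : Unit ⊕ Fin d) (u v : Unit) (ht : t ∈ J) (hx : x ∈ V) :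
    partialDeriv (stBasis d) m (fun z => G z (Sum.inl u) (Sum.inl v)) (t, x) = 0 :=
  partialDeriv_eq_zero_of_eq_const m h.isOpen_base h.isOpen_fibre (c := -1)
    (fun s hs z hz => by simp [h.eq_fromBlocks s hs z hz]) ht hx

theorem partialDeriv_inl_inr (m : Unit ⊕ Fin d) (u : Unit) (i : Fin d) (ht : t ∈ J) (hx : x ∈ V) :
    partialDeriv (stBasis d) m (fun z => G z (Sum.inl u) (Sum.inr i)) (t, x) = 0 :=
  partialDeriv_eq_zero_of_eq_const m h.isOpen_base h.isOpen_fibre (c := 0)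
    (fun s hs z hz => by simp [h.eq_fromBlocks s hs z hz]) ht hx

theorem partialDeriv_inr_inl (m : Unit ⊕ Fin d) (u : Unit) (i : Fin d) (ht : t ∈ J) (hx : x ∈ V) :
    partialDeriv (stBasis d) m (fun z => G z (Sum.inr i) (Sum.inl u)) (t, x) = 0 :=
  partialDeriv_eq_zero_of_eq_const m h.isOpen_base h.isOpen_fibre (c := 0)
    (fun s hs z hz => by simp [h.eq_fromBlocks s hs z hz]) ht hx

theorem partialDeriv_time_inr_inr (u : Unit) (i j : Fin d) (ht : t ∈ J) (hx : x ∈ V) :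
    partialDeriv (stBasis d) (Sum.inl u) (fun z => G z (Sum.inr i) (Sum.inr j)) (t, x)
      = 2 * a t * deriv a t * Gs x i j := by
  rw [partialDeriv_inl_of_eq_mul (φ := fun s => a s ^ 2) (ψ := fun z => Gs z i j) u
    h.isOpen_base h.isOpen_fibre
    (fun s hs z hz => by simp [h.eq_fromBlocks s hs z hz]) ht hx
    ((h.hasDerivAt_scale ht).differentiableAt.pow 2)
    (h.differentiableAt_of_fibre (h.contDiffOn_fibre i j) hx),
    ((h.hasDerivAt_scale ht).fun_pow 2).deriv]
  simp

theorem partialDeriv_space_inr_inr (k i j : Fin d) (ht : t ∈ J) (hx : x ∈ V) :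
    partialDeriv (stBasis d) (Sum.inr k) (fun z => G z (Sum.inr i) (Sum.inr j)) (t, x)
      = a t ^ 2 * partialDeriv (fibBasis d) k (fun z => Gs z i j) x := by
  rw [partialDeriv_inr_of_eq_mul (φ := fun s => a s ^ 2) (ψ := fun z => Gs z i j) k
    h.isOpen_base h.isOpen_fibre
    (fun s hs z hz => by simp [h.eq_fromBlocks s hs z hz]) ht hx
    ((h.hasDerivAt_scale ht).differentiableAt.pow 2)
    (h.differentiableAt_of_fibre (h.contDiffOn_fibre i j) hx)]

/-! #### Christoffel symbols -/

theorem christoffel_time_time_left (u v : Unit) (m : Unit ⊕ Fin d) (ht : t ∈ J) (hx : x ∈ V) :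
    christoffel (stBasis d) G (Sum.inl u) (Sum.inl v) m (t, x) = 0 := by
  rcases m with w | i <;>
  simp [christoffel, h.inv_eq ht hx, h.partialDeriv_inl_inl _ _ _ ht hx,
    h.partialDeriv_inl_inr _ _ _ ht hx, h.partialDeriv_inr_inl _ _ _ ht hx]

theorem christoffel_time_time_right (u v : Unit) (m : Unit ⊕ Fin d) (ht : t ∈ J) (hx : x ∈ V) :
    christoffel (stBasis d) G (Sum.inl u) m (Sum.inl v) (t, x) = 0 := by
  rcases m with w | i <;>
  simp [christoffel, h.inv_eq ht hx, h.partialDeriv_inl_inl _ _ _ ht hx,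
    h.partialDeriv_inl_inr _ _ _ ht hx, h.partialDeriv_inr_inl _ _ _ ht hx]

theorem christoffel_time_space (u : Unit) (i j : Fin d) (ht : t ∈ J) (hx : x ∈ V) :
    christoffel (stBasis d) G (Sum.inl u) (Sum.inr i) (Sum.inr j) (t, x)
      = a t * deriv a t * Gs x i j := by
  simp [christoffel, h.inv_eq ht hx, h.partialDeriv_time_inr_inr _ _ _ ht hx,
    h.partialDeriv_inr_inl _ _ _ ht hx]
  ring

theorem christoffel_space_time_time (k : Fin d) (u v : Unit) (ht : t ∈ J) (hx : x ∈ V) :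
    christoffel (stBasis d) G (Sum.inr k) (Sum.inl u) (Sum.inl v) (t, x) = 0 := by
  simp [christoffel, h.inv_eq ht hx, h.partialDeriv_inl_inl _ _ _ ht hx,
    h.partialDeriv_inl_inr _ _ _ ht hx]

/-- Only the time derivative of a² g* contributes; raising its index with a⁻² (g*)⁻¹ leaves H times
the identity. -/
theorem christoffel_space_time_space (k j : Fin d) (u : Unit) (ht : t ∈ J) (hx : x ∈ V) :
    christoffel (stBasis d) G (Sum.inr k) (Sum.inl u) (Sum.inr j) (t, x)
      = if k = j then deriv a t / a t else 0 := by
  have ha := h.scale_ne_zero ht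
  have h1 : ∀ l, (a t ^ 2)⁻¹ * (Gs x)⁻¹ k l * (2 * a t * deriv a t * Gs x j l)
      = 2 * (deriv a t / a t) * ((Gs x)⁻¹ k l * Gs x j l) := fun l => by field_simp
  simp only [christoffel, h.inv_eq ht hx, Fintype.sum_sum_type, Matrix.fromBlocks_apply₂₁,
    Matrix.fromBlocks_apply₂₂, h.partialDeriv_inl_inr _ _ _ ht hx,
    h.partialDeriv_time_inr_inr _ _ _ ht hx, Matrix.zero_apply, zero_mul, Finset.sum_const_zero,
    zero_add, add_zero, sub_zero, Matrix.smul_apply, smul_eq_mul, h1, ← Finset.mul_sum,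
    h.sum_inv_mul hx]
  split_ifs <;> ring

theorem christoffel_space_space_time (k j : Fin d) (u : Unit) (ht : t ∈ J) (hx : x ∈ V) :
    christoffel (stBasis d) G (Sum.inr k) (Sum.inr j) (Sum.inl u) (t, x)
      = if k = j then deriv a t / a t else 0 := by
  rw [← h.christoffel_space_time_space k j u ht hx]
  simp [christoffel, h.inv_eq ht hx, h.partialDeriv_inl_inr _ _ _ ht hx,
    h.partialDeriv_inr_inl _ _ _ ht hx]

/-- The factors a² and a⁻² cancel, so the spatial connection coefficients are those of the fibre at
every time. -/
theorem christoffel_space (k i j : Fin d) (ht : t ∈ J) (hx : x ∈ V) :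
    christoffel (stBasis d) G (Sum.inr k) (Sum.inr i) (Sum.inr j) (t, x)
      = christoffel (fibBasis d) Gs k i j x := by
  have ha := h.scale_ne_zero ht
  simp only [christoffel, h.inv_eq ht hx, Fintype.sum_sum_type, Matrix.fromBlocks_apply₂₁,
    Matrix.fromBlocks_apply₂₂, h.partialDeriv_space_inr_inr _ _ _ ht hx,
    Matrix.zero_apply, zero_mul, Finset.sum_const_zero, zero_add, Matrix.smul_apply, smul_eq_mul]
  congr 1
  exact Finset.sum_congr rfl fun l _ => by field_simp

end IsWarpedProduct

end WarpedCoordinates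

/-! ### The Ricci tensor of a warped product. -/

section WarpedCurvature

variable {d : ℕ} {J : Set ℝ} {V : Set (Fib d)} {t : ℝ} {x : Fib d}

namespace IsWarpedProduct

variable {a : ℝ → ℝ} {Gs : Fib d → Matrix (Fin d) (Fin d) ℝ}
  {G : ℝ × Fib d → Matrix (Unit ⊕ Fin d) (Unit ⊕ Fin d) ℝ}
  (h : IsWarpedProduct J a V Gs G)
include h

/-! #### Derivatives of the Christoffel symbols -/

theorem hasDerivAt_hubble (ht : t ∈ J) :
    HasDerivAt (fun s => deriv a s / a s)
      ((deriv (deriv a) t * a t - deriv a t * deriv a t) / a t ^ 2) t :=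
  (h.hasDerivAt_deriv ht).div (h.hasDerivAt_scale ht) (h.scale_ne_zero ht)

theorem partialDeriv_christoffel_time (m : Unit ⊕ Fin d) (u v : Unit) (k : Unit ⊕ Fin d)
    (ht : t ∈ J) (hx : x ∈ V) :
    partialDeriv (stBasis d) m (christoffel (stBasis d) G (Sum.inl u) (Sum.inl v) k) (t, x) = 0 ∧
    partialDeriv (stBasis d) m (christoffel (stBasis d) G (Sum.inl u) k (Sum.inl v)) (t, x) = 0 :=
  ⟨partialDeriv_eq_zero_of_eq_const m h.isOpen_base h.isOpen_fibre
    (fun _ hs _ hz => h.christoffel_time_time_left u v k hs hz) ht hx,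
  partialDeriv_eq_zero_of_eq_const m h.isOpen_base h.isOpen_fibre
    (fun _ hs _ hz => h.christoffel_time_time_right u v k hs hz) ht hx⟩

theorem partialDeriv_christoffel_space_time_time (m : Unit ⊕ Fin d) (k : Fin d) (u v : Unit)
    (ht : t ∈ J) (hx : x ∈ V) :
    partialDeriv (stBasis d) m (christoffel (stBasis d) G (Sum.inr k) (Sum.inl u) (Sum.inl v))
      (t, x) = 0 :=
  partialDeriv_eq_zero_of_eq_const m h.isOpen_base h.isOpen_fibre
    (fun _ hs _ hz => h.christoffel_space_time_time k u v hs hz) ht hx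

theorem partialDeriv_time_christoffel_hubble (w u : Unit) (k j : Fin d)
    (ht : t ∈ J) (hx : x ∈ V) :
    partialDeriv (stBasis d) (Sum.inl w)
      (christoffel (stBasis d) G (Sum.inr k) (Sum.inl u) (Sum.inr j)) (t, x)
      = if k = j then (deriv (deriv a) t * a t - deriv a t * deriv a t) / a t ^ 2 else 0 := by
  rw [partialDeriv_inl_of_eq_mul (φ := fun s => deriv a s / a s)
    (ψ := fun _ => if k = j then 1 else 0) w h.isOpen_base h.isOpen_fibre
    (fun s hs z hz => by rw [h.christoffel_space_time_space k j u hs hz]; simp) ht hx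
    (h.hasDerivAt_hubble ht).differentiableAt (differentiableAt_const _),
    (h.hasDerivAt_hubble ht).deriv]
  simp

theorem partialDeriv_space_christoffel_hubble (i : Fin d) (u : Unit) (k j : Fin d)
    (ht : t ∈ J) (hx : x ∈ V) :
    partialDeriv (stBasis d) (Sum.inr i)
      (christoffel (stBasis d) G (Sum.inr k) (Sum.inl u) (Sum.inr j)) (t, x) = 0 ∧
    partialDeriv (stBasis d) (Sum.inr i)
      (christoffel (stBasis d) G (Sum.inr k) (Sum.inr j) (Sum.inl u)) (t, x) = 0 := by
  constructor
  · rw [partialDeriv_inr_of_eq_mul (φ := fun s => deriv a s / a s)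
      (ψ := fun _ => if k = j then 1 else 0) i h.isOpen_base h.isOpen_fibre
      (fun s hs z hz => by rw [h.christoffel_space_time_space k j u hs hz]; simp) ht hx
      (h.hasDerivAt_hubble ht).differentiableAt (differentiableAt_const _)]
    simp [partialDeriv]
  · rw [partialDeriv_inr_of_eq_mul (φ := fun s => deriv a s / a s)
      (ψ := fun _ => if k = j then 1 else 0) i h.isOpen_base h.isOpen_fibre
      (fun s hs z hz => by rw [h.christoffel_space_space_time k j u hs hz]; simp) ht hx
      (h.hasDerivAt_hubble ht).differentiableAt (differentiableAt_const _)]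
    simp [partialDeriv]

theorem partialDeriv_christoffel_time_space (w u : Unit) (i j : Fin d)
    (ht : t ∈ J) (hx : x ∈ V) :
    partialDeriv (stBasis d) (Sum.inl w)
      (christoffel (stBasis d) G (Sum.inl u) (Sum.inr i) (Sum.inr j)) (t, x)
      = (deriv a t * deriv a t + a t * deriv (deriv a) t) * Gs x i j := by
  have hd := (h.hasDerivAt_scale ht).fun_mul (h.hasDerivAt_deriv ht)
  rw [partialDeriv_inl_of_eq_mul (φ := fun s => a s * deriv a s)
    (ψ := fun z => Gs z i j) w h.isOpen_base h.isOpen_fibre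
    (fun s hs z hz => h.christoffel_time_space u i j hs hz) ht hx
    hd.differentiableAt (h.differentiableAt_of_fibre (h.contDiffOn_fibre i j) hx), hd.deriv]

theorem differentiableAt_christoffel_fibre (k i j : Fin d) (hx : x ∈ V) :
    DifferentiableAt ℝ (christoffel (fibBasis d) Gs k i j) x :=
  h.differentiableAt_of_fibre
    (contDiffOn_christoffel h.isOpen_fibre h.contDiffOn_fibre h.isUnit_det_fibre k i j) hx

theorem partialDeriv_time_christoffel_space (w : Unit) (k i j : Fin d) (ht : t ∈ J) (hx : x ∈ V) :
    partialDeriv (stBasis d) (Sum.inl w)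
      (christoffel (stBasis d) G (Sum.inr k) (Sum.inr i) (Sum.inr j)) (t, x) = 0 := by
  rw [partialDeriv_inl_of_eq_mul (φ := fun _ => 1)
    (ψ := christoffel (fibBasis d) Gs k i j) w h.isOpen_base h.isOpen_fibre
    (fun s hs z hz => by rw [h.christoffel_space k i j hs hz, one_mul]) ht hx
    (differentiableAt_const _) (h.differentiableAt_christoffel_fibre k i j hx)]
  simp

theorem partialDeriv_space_christoffel_space (m k i j : Fin d) (ht : t ∈ J) (hx : x ∈ V) :
    partialDeriv (stBasis d) (Sum.inr m)
      (christoffel (stBasis d) G (Sum.inr k) (Sum.inr i) (Sum.inr j)) (t, x)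
      = partialDeriv (fibBasis d) m (christoffel (fibBasis d) Gs k i j) x := by
  rw [partialDeriv_inr_of_eq_mul (φ := fun _ => 1)
    (ψ := christoffel (fibBasis d) Gs k i j) m h.isOpen_base h.isOpen_fibre
    (fun s hs z hz => by rw [h.christoffel_space k i j hs hz, one_mul]) ht hx
    (differentiableAt_const _) (h.differentiableAt_christoffel_fibre k i j hx), one_mul]

/-! #### The Ricci tensor -/

theorem ricciCoord_time_time (u v : Unit) (ht : t ∈ J) (hx : x ∈ V) :
    ricciCoord (stBasis d) G (Sum.inl u) (Sum.inl v) (t, x)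
      = -(d * (deriv (deriv a) t / a t)) := by
  have ha := h.scale_ne_zero ht
  simp only [ricciCoord, Fintype.sum_sum_type, h.partialDeriv_christoffel_time _ _ _ _ ht hx,
    h.partialDeriv_christoffel_space_time_time _ _ _ _ ht hx,
    h.partialDeriv_time_christoffel_hubble _ _ _ _ ht hx,
    h.christoffel_time_time_left _ _ _ ht hx, h.christoffel_space_time_time _ _ _ ht hx,
    h.christoffel_space_time_space _ _ _ ht hx]
  simp
  field_simp
  ring

/-- What survives is H times Γ*ᵏₖᵢ - Γ*ᵏᵢₖ, which vanishes because the fibre connection is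
torsion-free. The coordinate formula for Ricci is not manifestly symmetric, so the transposed
component is computed separately. -/
theorem ricciCoord_time_space (u : Unit) (i : Fin d) (ht : t ∈ J) (hx : x ∈ V) :
    ricciCoord (stBasis d) G (Sum.inl u) (Sum.inr i) (t, x) = 0 := by
  simp only [ricciCoord, Fintype.sum_sum_type, h.partialDeriv_christoffel_time _ _ _ _ ht hx,
    h.partialDeriv_space_christoffel_hubble _ _ _ _ ht hx,
    h.christoffel_time_time_left _ _ _ ht hx, h.christoffel_time_time_right _ _ _ ht hx,
    h.christoffel_space_time_time _ _ _ ht hx, h.christoffel_space_time_space _ _ _ ht hx,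
    h.christoffel_space_space_time _ _ _ ht hx, h.christoffel_space _ _ _ ht hx]
  simp [christoffel_symm h.isOpen_fibre h.isSymm_fibre _ i _ hx]

theorem ricciCoord_space_time (u : Unit) (i : Fin d) (ht : t ∈ J) (hx : x ∈ V) :
    ricciCoord (stBasis d) G (Sum.inr i) (Sum.inl u) (t, x) = 0 := by
  simp only [ricciCoord, Fintype.sum_sum_type, h.partialDeriv_christoffel_time _ _ _ _ ht hx,
    h.partialDeriv_space_christoffel_hubble _ _ _ _ ht hx,
    h.partialDeriv_time_christoffel_space _ _ _ _ ht hx,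
    h.christoffel_time_time_left _ _ _ ht hx, h.christoffel_time_time_right _ _ _ ht hx,
    h.christoffel_space_time_time _ _ _ ht hx, h.christoffel_space_time_space _ _ _ ht hx,
    h.christoffel_space_space_time _ _ _ ht hx, h.christoffel_space _ _ _ ht hx]
  simp [christoffel_symm h.isOpen_fibre h.isSymm_fibre _ i _ hx, mul_comm (deriv a t / a t)]

/-- Beyond the fibre's own Ricci tensor, only terms through a time index remain: (a a')' from the
derivative, d a'² from the trace of the connection, and -2 a'² from the two quadratic terms. -/
theorem ricciCoord_space_space (i j : Fin d) (ht : t ∈ J) (hx : x ∈ V) :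
    ricciCoord (stBasis d) G (Sum.inr i) (Sum.inr j) (t, x)
      = ricciCoord (fibBasis d) Gs i j x
        + (a t * deriv (deriv a) t + (d - 1) * deriv a t ^ 2) * Gs x i j := by
  have ha := h.scale_ne_zero ht
  simp only [ricciCoord, Fintype.sum_sum_type, h.partialDeriv_christoffel_time _ _ _ _ ht hx,
    h.partialDeriv_christoffel_time_space _ _ _ _ ht hx,
    h.partialDeriv_space_christoffel_space _ _ _ _ ht hx,
    h.christoffel_time_time_left _ _ _ ht hx, h.christoffel_time_time_right _ _ _ ht hx,
    h.christoffel_time_space _ _ _ ht hx, h.christoffel_space_space_time _ _ _ ht hx, h.christoffel_space _ _ _ ht hx]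
  simp [Finset.sum_add_distrib, (h.isSymm_fibre x hx).apply i j]
  field_simp
  ring

end IsWarpedProduct

end WarpedCurvature

/-! ### Scalar curvature, the contracted Bianchi identity and components of ∇Ric. -/

section WarpedGray

/-- The eigenvalue `ξ = d a'' / a` of the Ricci tensor of a warped product along `∂ₜ`. -/
noncomputable def warpedEigenvalue (d : ℕ) (a : ℝ → ℝ) (t : ℝ) : ℝ :=
  d * (deriv (deriv a) t / a t)

/-- The scalar curvature at time `t` of a warped product over a fibre with scalar
curvature `s`. -/
noncomputable def warpedScalar (d : ℕ) (a : ℝ → ℝ) (s t : ℝ) : ℝ :=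
  2 * d * (deriv (deriv a) t / a t) + d * (d - 1) * (deriv a t / a t) ^ 2 + s / a t ^ 2

variable {d : ℕ} {J : Set ℝ} {V : Set (Fib d)} {t : ℝ} {x : Fib d}

namespace IsWarpedProduct

variable {a : ℝ → ℝ} {Gs : Fib d → Matrix (Fin d) (Fin d) ℝ}
  {G : ℝ × Fib d → Matrix (Unit ⊕ Fin d) (Unit ⊕ Fin d) ℝ}
  (h : IsWarpedProduct J a V Gs G)
include h

/-! #### Scalar curvature -/

theorem sum_inv_mul_metric (hx : x ∈ V) : ∑ i, ∑ j, (Gs x)⁻¹ i j * Gs x i j = d := by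
  have h1 : ∀ i, ∑ j, (Gs x)⁻¹ i j * Gs x i j = 1 := fun i => by
    rw [h.sum_inv_mul hx, if_pos rfl]
  simp [h1]

theorem scalarCoord_fibre_of_einstein {c : ℝ} (hx : x ∈ V)
    (hE : ∀ i j, ricciCoord (fibBasis d) Gs i j x = c * Gs x i j) :
    scalarCoord (fibBasis d) Gs x = d * c := by
  rw [scalarCoord, ← h.sum_inv_mul_metric hx, Finset.sum_mul]
  refine Finset.sum_congr rfl fun i _ => ?_
  rw [Finset.sum_mul]
  refine Finset.sum_congr rfl fun j _ => ?_
  rw [hE]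
  ring

theorem scalarCoord_eq (ht : t ∈ J) (hx : x ∈ V) :
    scalarCoord (stBasis d) G (t, x) = warpedScalar d a (scalarCoord (fibBasis d) Gs x) t := by
  have ha := h.scale_ne_zero ht
  have h1 : ∀ i j, (a t ^ 2)⁻¹ * (Gs x)⁻¹ i j * (ricciCoord (fibBasis d) Gs i j x
        + (a t * deriv (deriv a) t + (d - 1) * deriv a t ^ 2) * Gs x i j)
      = (a t ^ 2)⁻¹ * ((Gs x)⁻¹ i j * ricciCoord (fibBasis d) Gs i j x)
        + (a t ^ 2)⁻¹ * (a t * deriv (deriv a) t + (d - 1) * deriv a t ^ 2)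
          * ((Gs x)⁻¹ i j * Gs x i j) := fun i j => by ring
  simp only [scalarCoord, Fintype.sum_sum_type, h.inv_eq ht hx, h.ricciCoord_time_time _ _ ht hx,
    h.ricciCoord_time_space _ _ ht hx, h.ricciCoord_space_time _ _ ht hx,
    h.ricciCoord_space_space _ _ ht hx, Matrix.fromBlocks_apply₁₁, Matrix.fromBlocks_apply₂₂,
    Matrix.smul_apply, smul_eq_mul, h1, Finset.sum_add_distrib, ← Finset.mul_sum,
    h.sum_inv_mul_metric hx]
  simp [warpedScalar]
  field_simp
  ring

theorem hasDerivAt_warpedEigenvalue (ht : t ∈ J) :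
    HasDerivAt (warpedEigenvalue d a) (d * ((deriv (deriv (deriv a)) t * a t
      - deriv (deriv a) t * deriv a t) / a t ^ 2)) t :=
  ((h.hasDerivAt_deriv_deriv ht).div (h.hasDerivAt_scale ht) (h.scale_ne_zero ht)).const_mul _

theorem hasDerivAt_warpedScalar (s : ℝ) (ht : t ∈ J) :
    HasDerivAt (warpedScalar d a s)
      (2 * (d * ((deriv (deriv (deriv a)) t * a t - deriv (deriv a) t * deriv a t) / a t ^ 2))
        + 2 * d * (d - 1) * (deriv a t / a t)
          * ((deriv (deriv a) t * a t - deriv a t * deriv a t) / a t ^ 2)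
        - 2 * s * deriv a t / a t ^ 3) t := by
  have ha := h.scale_ne_zero ht
  have h1 := ((h.hasDerivAt_deriv_deriv ht).div (h.hasDerivAt_scale ht) ha).const_mul
    (2 * d : ℝ)
  have h2 := ((h.hasDerivAt_hubble ht).fun_pow 2).const_mul (d * (d - 1) : ℝ)
  have h3 := (hasDerivAt_const t s).div ((h.hasDerivAt_scale ht).fun_pow 2) (pow_ne_zero 2 ha)
  refine ((h1.add h2).add h3).congr_deriv ?_
  simp only [Nat.cast_ofNat, Nat.add_one_sub_one, pow_one]
  field_simp
  ring

/-- The time component of the contracted Bianchi identity. -/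
theorem deriv_warpedScalar_sub (s : ℝ) (ht : t ∈ J) :
    deriv (warpedScalar d a s) t - 2 * deriv (warpedEigenvalue d a) t
      = 2 * (deriv a t / a t) * ((d + 1) * warpedEigenvalue d a t - warpedScalar d a s t) := by
  have ha := h.scale_ne_zero ht
  rw [(h.hasDerivAt_warpedScalar s ht).deriv, (h.hasDerivAt_warpedEigenvalue ht).deriv,
    warpedScalar, warpedEigenvalue]
  field_simp
  ring

theorem differentiableAt_scalarCoord (ht : t ∈ J) (hx : x ∈ V) :
    DifferentiableAt ℝ (scalarCoord (stBasis d) G) (t, x) := by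
  have ha := h.scale_ne_zero ht
  have hfst : ∀ {f : ℝ → ℝ}, DifferentiableAt ℝ f t →
      DifferentiableAt ℝ (fun y : ℝ × Fib d => f y.1) (t, x) :=
    fun hf => hf.comp (t, x) differentiableAt_fst
  have hs : DifferentiableAt ℝ (fun y : ℝ × Fib d => scalarCoord (fibBasis d) Gs y.2) (t, x) :=
    DifferentiableAt.comp (g := scalarCoord (fibBasis d) Gs) (t, x)
      (h.differentiableAt_of_fibre (contDiffOn_scalarCoord h.isOpen_fibre h.contDiffOn_fibre
        h.isUnit_det_fibre) hx) differentiableAt_snd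
  have hg : DifferentiableAt ℝ
      (fun y : ℝ × Fib d => warpedScalar d a (scalarCoord (fibBasis d) Gs y.2) y.1) (t, x) := by
    -- The scalar curvature is affine in the fibre curvature s: its value at s = 0 plus s a⁻². This
    -- separates the two variables.
    have hw := hfst (h.hasDerivAt_warpedScalar 0 ht).differentiableAt
    have hi := hfst (f := fun s => (a s ^ 2)⁻¹)
      (((h.hasDerivAt_scale ht).differentiableAt.pow 2).inv (pow_ne_zero 2 ha))
    have he := hw.add (hs.mul hi)
    refine he.congr_of_eventuallyEq (Filter.Eventually.of_forall fun y => ?_)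
    simp [warpedScalar, div_eq_mul_inv]
  exact hg.congr_of_eventuallyEq (Filter.eventuallyEq_of_mem
    ((h.isOpen_base.prod h.isOpen_fibre).mem_nhds ⟨ht, hx⟩)
    fun y hy => h.scalarCoord_eq hy.1 hy.2)

theorem partialDeriv_time_scalarCoord (u : Unit) (ht : t ∈ J) (hx : x ∈ V) :
    partialDeriv (stBasis d) (Sum.inl u) (scalarCoord (stBasis d) G) (t, x)
      = deriv (warpedScalar d a (scalarCoord (fibBasis d) Gs x)) t := by
  rw [partialDeriv_inl u (h.differentiableAt_scalarCoord ht hx)]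
  exact Filter.EventuallyEq.deriv_eq (Filter.eventuallyEq_of_mem (h.isOpen_base.mem_nhds ht)
    fun s hs => h.scalarCoord_eq hs hx)

/-! #### Covariant derivative of the Ricci tensor -/

theorem partialDeriv_ricciCoord_mixed (m : Unit ⊕ Fin d) (u : Unit) (i : Fin d)
    (ht : t ∈ J) (hx : x ∈ V) :
    partialDeriv (stBasis d) m (ricciCoord (stBasis d) G (Sum.inl u) (Sum.inr i)) (t, x) = 0 ∧
    partialDeriv (stBasis d) m (ricciCoord (stBasis d) G (Sum.inr i) (Sum.inl u)) (t, x) = 0 :=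
  ⟨partialDeriv_eq_zero_of_eq_const m h.isOpen_base h.isOpen_fibre
    (fun _ hs _ hz => h.ricciCoord_time_space u i hs hz) ht hx,
  partialDeriv_eq_zero_of_eq_const m h.isOpen_base h.isOpen_fibre
    (fun _ hs _ hz => h.ricciCoord_space_time u i hs hz) ht hx⟩

theorem partialDeriv_time_ricciCoord_time (w u v : Unit) (ht : t ∈ J) (hx : x ∈ V) :
    partialDeriv (stBasis d) (Sum.inl w) (ricciCoord (stBasis d) G (Sum.inl u) (Sum.inl v)) (t, x)
      = -deriv (warpedEigenvalue d a) t := by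
  rw [partialDeriv_inl_of_eq_mul (φ := warpedEigenvalue d a) (ψ := fun _ => -1) w
    h.isOpen_base h.isOpen_fibre
    (fun s hs z hz => by rw [h.ricciCoord_time_time u v hs hz, warpedEigenvalue]; ring) ht hx
    (h.hasDerivAt_warpedEigenvalue ht).differentiableAt (differentiableAt_const _)]
  simp

theorem partialDeriv_space_ricciCoord_time (i : Fin d) (u v : Unit) (ht : t ∈ J) (hx : x ∈ V) :
    partialDeriv (stBasis d) (Sum.inr i) (ricciCoord (stBasis d) G (Sum.inl u) (Sum.inl v)) (t, x)
      = 0 := by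
  rw [partialDeriv_inr_of_eq_mul (φ := warpedEigenvalue d a) (ψ := fun _ => -1) i
    h.isOpen_base h.isOpen_fibre
    (fun s hs z hz => by rw [h.ricciCoord_time_time u v hs hz, warpedEigenvalue]; ring) ht hx
    (h.hasDerivAt_warpedEigenvalue ht).differentiableAt (differentiableAt_const _)]
  simp [partialDeriv]

theorem nablaRicciCoord_time_time_time (u v w : Unit) (ht : t ∈ J) (hx : x ∈ V) :
    nablaRicciCoord (stBasis d) G (Sum.inl u) (Sum.inl v) (Sum.inl w) (t, x)
      = -deriv (warpedEigenvalue d a) t := by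
  simp [nablaRicciCoord, h.partialDeriv_time_ricciCoord_time _ _ _ ht hx,
    h.christoffel_time_time_left _ _ _ ht hx, h.christoffel_space_time_time _ _ _ ht hx]

/-- Since R_tj vanishes identically, only connection terms survive. They involve the spatial Ricci
tensor undifferentiated, which makes this the component that detects whether the fibre is Einstein.
-/
theorem nablaRicciCoord_space_time_space (u : Unit) (i j : Fin d) (ht : t ∈ J) (hx : x ∈ V) :
    nablaRicciCoord (stBasis d) G (Sum.inr i) (Sum.inl u) (Sum.inr j) (t, x)
      = -(deriv a t / a t) * ricciCoord (stBasis d) G (Sum.inr i) (Sum.inr j) (t, x)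
        + a t * deriv a t * warpedEigenvalue d a t * Gs x i j := by
  simp only [nablaRicciCoord, h.partialDeriv_ricciCoord_mixed _ _ _ ht hx, Fintype.sum_sum_type,
    h.christoffel_time_time_right _ _ _ ht hx, h.christoffel_space_space_time _ _ _ ht hx,
    h.christoffel_time_space _ _ _ ht hx, h.ricciCoord_time_space _ _ ht hx,
    h.ricciCoord_time_time _ _ ht hx, warpedEigenvalue]
  simp
  ring

theorem nablaRicciCoord_space_space_time (u : Unit) (i j : Fin d) (ht : t ∈ J) (hx : x ∈ V) :
    nablaRicciCoord (stBasis d) G (Sum.inr i) (Sum.inr j) (Sum.inl u) (t, x)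
      = -(deriv a t / a t) * ricciCoord (stBasis d) G (Sum.inr j) (Sum.inr i) (t, x)
        + a t * deriv a t * warpedEigenvalue d a t * Gs x i j := by
  simp only [nablaRicciCoord, h.partialDeriv_ricciCoord_mixed _ _ _ ht hx, Fintype.sum_sum_type,
    h.christoffel_time_time_right _ _ _ ht hx, h.christoffel_space_space_time _ _ _ ht hx,
    h.christoffel_time_space _ _ _ ht hx, h.ricciCoord_space_time _ _ ht hx,
    h.ricciCoord_time_time _ _ ht hx, warpedEigenvalue]
  simp
  ring

theorem nablaRicciCoord_space_time_time (u v : Unit) (i : Fin d) (ht : t ∈ J) (hx : x ∈ V) :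
    nablaRicciCoord (stBasis d) G (Sum.inr i) (Sum.inl u) (Sum.inl v) (t, x) = 0 := by
  simp [nablaRicciCoord, h.partialDeriv_space_ricciCoord_time _ _ _ ht hx,
    h.christoffel_time_time_right _ _ _ ht hx, h.ricciCoord_time_space _ _ ht hx,
    h.ricciCoord_space_time _ _ ht hx]

theorem nablaRicciCoord_time_time_space (u v : Unit) (i : Fin d) (ht : t ∈ J) (hx : x ∈ V) :
    nablaRicciCoord (stBasis d) G (Sum.inl u) (Sum.inl v) (Sum.inr i) (t, x) = 0 ∧
    nablaRicciCoord (stBasis d) G (Sum.inl u) (Sum.inr i) (Sum.inl v) (t, x) = 0 := by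
  simp [nablaRicciCoord, h.partialDeriv_ricciCoord_mixed _ _ _ ht hx,
    h.christoffel_time_time_left _ _ _ ht hx, h.christoffel_space_time_time _ _ _ ht hx,
    h.ricciCoord_time_space _ _ ht hx, h.ricciCoord_space_time _ _ ht hx]

end IsWarpedProduct

end WarpedGray

/-! ### The Sinyukov condition and Einstein fibres, in coordinates. -/

section WarpedSinyukov

variable {d : ℕ} {J : Set ℝ} {V : Set (Fib d)} {t : ℝ} {x : Fib d}

namespace IsWarpedProduct

variable {a : ℝ → ℝ} {Gs : Fib d → Matrix (Fin d) (Fin d) ℝ}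
  {G : ℝ × Fib d → Matrix (Unit ⊕ Fin d) (Unit ⊕ Fin d) ℝ}
  (h : IsWarpedProduct J a V Gs G)
include h

/-! #### Consequences of the Sinyukov condition -/

/-- As g_tt = -1, the subtracted part is -(a_t + 2 b_t), and the two Gray coefficients add up to
2/(n + 2) times R', with n + 2 = d + 3. -/
theorem grayTraceFree_time_time_time (hd : 0 < d) (u v w : Unit) (ht : t ∈ J) (hx : x ∈ V) :
    grayTraceFree (stBasis d) G (Sum.inl u) (Sum.inl v) (Sum.inl w) (t, x)
      = 2 / ((d : ℝ) + 3) * deriv (warpedScalar d a (scalarCoord (fibBasis d) Gs x)) t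
        - deriv (warpedEigenvalue d a) t := by
  have hd' : (d : ℝ) ≠ 0 := by positivity
  have hd3 : (1 : ℝ) + d + 2 ≠ 0 := by positivity
  have hd4 : (d : ℝ) + 3 ≠ 0 := by positivity
  have hd5 : (1 : ℝ) + d - 1 ≠ 0 := by simpa using hd'
  simp only [grayTraceFree, h.nablaRicciCoord_time_time_time _ _ _ ht hx, grayA, grayB,
    h.partialDeriv_time_scalarCoord _ ht hx, h.eq_fromBlocks t ht x hx,
    Matrix.fromBlocks_apply₁₁, Matrix.neg_apply, Matrix.one_apply_eq, Fintype.card_sum,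
    Fintype.card_unit, Fintype.card_fin, Nat.cast_add, Nat.cast_one]
  field_simp
  ring

theorem ricciCoord_fibre_of_grayTraceFree (ht : t ∈ J) (hx : x ∈ V) (hda : deriv a t ≠ 0)
    (hgray : ∀ i j : Fin d,
      grayTraceFree (stBasis d) G (Sum.inr i) (Sum.inl ()) (Sum.inr j) (t, x) = 0) :
    ∃ c : ℝ, ∀ i j, ricciCoord (fibBasis d) Gs i j x = c * Gs x i j := by
  have ha := h.scale_ne_zero ht
  -- The constant solves -H (R* + κ g*) + a a' ξ g* = b_t a² g* for R*, where κ = a a'' + (d - 1)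
  -- a'²; this divides by a'.
  refine ⟨a t ^ 2 * warpedEigenvalue d a t
    - a t ^ 3 / deriv a t * grayB (stBasis d) G (Sum.inl ()) (t, x)
    - (a t * deriv (deriv a) t + (d - 1) * deriv a t ^ 2), fun i j => ?_⟩
  have h1 := hgray i j
  simp only [grayTraceFree, h.nablaRicciCoord_space_time_space _ _ _ ht hx,
    h.ricciCoord_space_space _ _ ht hx, h.eq_fromBlocks t ht x hx,
    Matrix.fromBlocks_apply₁₂, Matrix.fromBlocks_apply₂₁, Matrix.fromBlocks_apply₂₂,
    Matrix.zero_apply, mul_zero, zero_add, add_zero, Matrix.smul_apply, smul_eq_mul] at h1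
  field_simp at h1 ⊢
  linear_combination -h1

/-! #### Einstein fibres -/

variable {c : ℝ}
  (hE : ∀ z ∈ V, ∀ i j, ricciCoord (fibBasis d) Gs i j z = c * Gs z i j)
include hE

/-- The spatial block is now pure trace, and its trace is R - ξ because the time direction
contributes ξ to R. -/
theorem ricciCoord_space_space_of_einstein (hd : 0 < d) (i j : Fin d) (ht : t ∈ J) (hx : x ∈ V) :
    ricciCoord (stBasis d) G (Sum.inr i) (Sum.inr j) (t, x)
      = a t ^ 2 * ((warpedScalar d a (d * c) t - warpedEigenvalue d a t) / d) * Gs x i j := by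
  have ha := h.scale_ne_zero ht
  have hd' : (d : ℝ) ≠ 0 := by positivity
  rw [h.ricciCoord_space_space i j ht hx, hE x hx, warpedScalar, warpedEigenvalue]
  field_simp
  ring

theorem partialDeriv_scalarCoord_of_einstein (ht : t ∈ J) (hx : x ∈ V) :
    (∀ u, partialDeriv (stBasis d) (Sum.inl u) (scalarCoord (stBasis d) G) (t, x)
      = deriv (warpedScalar d a (d * c)) t) ∧
    ∀ i, partialDeriv (stBasis d) (Sum.inr i) (scalarCoord (stBasis d) G) (t, x) = 0 := by
  have hs : ∀ z ∈ V, scalarCoord (fibBasis d) Gs z = d * c := fun z hz =>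
    h.scalarCoord_fibre_of_einstein hz (hE z hz)
  refine ⟨fun u => by rw [h.partialDeriv_time_scalarCoord u ht hx, hs x hx], fun i => ?_⟩
  rw [partialDeriv_inr_of_eq_mul (φ := warpedScalar d a (d * c)) (ψ := fun _ => 1) i
    h.isOpen_base h.isOpen_fibre
    (fun s hs' z hz => by rw [h.scalarCoord_eq hs' hz, hs z hz, mul_one]) ht hx
    (h.hasDerivAt_warpedScalar _ ht).differentiableAt (differentiableAt_const _)]
  simp [partialDeriv]

/-- The derivative of the factor a² is cancelled by the two connection terms, each equal to H times
the component; only the scalar (R - ξ)/d is differentiated. -/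
theorem nablaRicciCoord_time_space_space (hd : 0 < d) (u : Unit) (i j : Fin d)
    (ht : t ∈ J) (hx : x ∈ V) :
    nablaRicciCoord (stBasis d) G (Sum.inl u) (Sum.inr i) (Sum.inr j) (t, x)
      = a t ^ 2 * ((deriv (warpedScalar d a (d * c)) t - deriv (warpedEigenvalue d a) t) / d)
        * Gs x i j := by
  have ha := h.scale_ne_zero ht
  have hφ := ((h.hasDerivAt_scale ht).fun_pow 2).fun_mul
    (((h.hasDerivAt_warpedScalar (d * c) ht).fun_sub
      (h.hasDerivAt_warpedEigenvalue ht)).div_const (d : ℝ))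
  rw [← (h.hasDerivAt_warpedScalar (d * c) ht).deriv,
    ← (h.hasDerivAt_warpedEigenvalue ht).deriv] at hφ
  have hp := partialDeriv_inl_of_eq_mul
    (φ := fun s => a s ^ 2 * ((warpedScalar d a (d * c) s - warpedEigenvalue d a s) / d))
    (ψ := fun z => Gs z i j) u h.isOpen_base h.isOpen_fibre
    (fun s hs z hz => h.ricciCoord_space_space_of_einstein hE hd i j hs hz) ht hx
    hφ.differentiableAt (h.differentiableAt_of_fibre (h.contDiffOn_fibre i j) hx)
  rw [hφ.deriv] at hp
  simp only [nablaRicciCoord, hp, Fintype.sum_sum_type,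
    h.christoffel_time_time_left _ _ _ ht hx, h.christoffel_space_time_space _ _ _ ht hx,
    h.ricciCoord_space_space_of_einstein hE hd _ _ ht hx]
  simp
  field_simp
  ring

/-- The spatial block is a function of time times g*, which is parallel for the fibre connection,
and the terms through the time index carry the vanishing R_ti. -/
theorem nablaRicciCoord_space_space_space (hd : 0 < d) (i j k : Fin d)
    (ht : t ∈ J) (hx : x ∈ V) :
    nablaRicciCoord (stBasis d) G (Sum.inr i) (Sum.inr j) (Sum.inr k) (t, x) = 0 := by
  have hp := partialDeriv_inr_of_eq_mul
    (φ := fun s => a s ^ 2 * ((warpedScalar d a (d * c) s - warpedEigenvalue d a s) / d))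
    (ψ := fun z => Gs z j k) i h.isOpen_base h.isOpen_fibre
    (fun s hs z hz => h.ricciCoord_space_space_of_einstein hE hd j k hs hz) ht hx
    (((h.hasDerivAt_scale ht).differentiableAt.fun_pow 2).fun_mul
      (((h.hasDerivAt_warpedScalar (d * c) ht).fun_sub
      (h.hasDerivAt_warpedEigenvalue ht)).div_const (d : ℝ)).differentiableAt)
    (h.differentiableAt_of_fibre (h.contDiffOn_fibre j k) hx)
  simp only [nablaRicciCoord, hp, Fintype.sum_sum_type,
    h.christoffel_space _ _ _ ht hx, h.ricciCoord_time_space _ _ ht hx,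
    h.ricciCoord_space_time _ _ ht hx, h.ricciCoord_space_space_of_einstein hE hd _ _ ht hx,
    partialDeriv_metric h.isOpen_fibre h.isSymm_fibre h.isUnit_det_fibre i j k hx, mul_add,
    Finset.mul_sum, mul_zero, Finset.sum_const_zero, zero_add, mul_left_comm]
  ring

/-- A warped product over an Einstein fibre satisfies the Sinyukov condition as soon as
`(n + 2) ξ' = 2 R'`. -/
theorem grayTraceFree_eq_zero_of_einstein (hd : 0 < d) (ht : t ∈ J) (hx : x ∈ V)
    (hode : ((d : ℝ) + 3) * deriv (warpedEigenvalue d a) t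
      = 2 * deriv (warpedScalar d a (d * c)) t) (j k l : Unit ⊕ Fin d) :
    grayTraceFree (stBasis d) G j k l (t, x) = 0 := by
  have ha := h.scale_ne_zero ht
  have hd' : (d : ℝ) ≠ 0 := by positivity
  have hd3 : (1 : ℝ) + d + 2 ≠ 0 := by positivity
  have hd4 : (d : ℝ) + 3 ≠ 0 := by positivity
  have hd5 : (1 : ℝ) + d - 1 ≠ 0 := by simpa using hd'
  obtain ⟨hpt, hps⟩ := h.partialDeriv_scalarCoord_of_einstein hE ht hx
  have hξ : deriv (warpedEigenvalue d a) t
      = 2 / ((d : ℝ) + 3) * deriv (warpedScalar d a (d * c)) t := by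
    field_simp
    linarith
  have hB := h.deriv_warpedScalar_sub (d * c) ht
  have hcard : (Fintype.card (Unit ⊕ Fin d) : ℝ) = 1 + d := by simp
  -- The left side is 2H(nξ - R) times a² g*/(2d). Bianchi replaces the first factor by R' - 2ξ',
  -- which the hypothesis on ξ' turns into (n - 2)/(n + 2) R'; the result is b_t g_ij.
  have hmix : ∀ i j, -(deriv a t / a t) *
      (a t ^ 2 * ((warpedScalar d a (d * c) t - warpedEigenvalue d a t) / d) * Gs x i j)
      + a t * deriv a t * warpedEigenvalue d a t * Gs x i j
      = (1 + d - 2) / (2 * (1 + d - 1) * (1 + d + 2)) * deriv (warpedScalar d a (d * c)) t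
        * (a t ^ 2 * Gs x i j) := fun i j => by
    have e1 : -(deriv a t / a t) *
      (a t ^ 2 * ((warpedScalar d a (d * c) t - warpedEigenvalue d a t) / d) * Gs x i j)
      + a t * deriv a t * warpedEigenvalue d a t * Gs x i j
      = (2 * (deriv a t / a t) * ((d + 1) * warpedEigenvalue d a t - warpedScalar d a (d * c) t))
        * (a t ^ 2 * Gs x i j / (2 * d)) := by
      field_simp
      ring
    rw [e1, ← hB, hξ]
    field_simp
    ring
  rcases j with u | i <;> rcases k with v | k <;> rcases l with w | l
  · rw [h.grayTraceFree_time_time_time hd u v w ht hx,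
      h.scalarCoord_fibre_of_einstein hx (hE x hx), hξ, sub_self]
  · simp [grayTraceFree, h.nablaRicciCoord_time_time_space _ _ _ ht hx, grayA, grayB, hpt, hps,
      h.eq_fromBlocks t ht x hx]
  · simp [grayTraceFree, h.nablaRicciCoord_time_time_space _ _ _ ht hx, grayA, grayB, hpt, hps,
      h.eq_fromBlocks t ht x hx]
  -- Here (R' - ξ')/d equals n/((n - 1)(n + 2)) R', which is a_t.
  · simp only [grayTraceFree, h.nablaRicciCoord_time_space_space hE hd _ _ _ ht hx, grayA, grayB,
      hpt, hps, h.eq_fromBlocks t ht x hx, Matrix.fromBlocks_apply₂₂, Matrix.fromBlocks_apply₁₂,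
      Matrix.smul_apply, smul_eq_mul, hcard, hξ]
    field_simp
    simp
    ring
  · simp [grayTraceFree, h.nablaRicciCoord_space_time_time _ _ _ ht hx, grayA, grayB, hpt, hps,
      h.eq_fromBlocks t ht x hx]
  · simp only [grayTraceFree, h.nablaRicciCoord_space_time_space _ _ _ ht hx, grayA, grayB,
      h.ricciCoord_space_space_of_einstein hE hd _ _ ht hx, hmix,
      hpt, hps, h.eq_fromBlocks t ht x hx, Matrix.fromBlocks_apply₂₂, Matrix.fromBlocks_apply₁₂,
      Matrix.fromBlocks_apply₂₁, Matrix.smul_apply, smul_eq_mul, hcard, Matrix.zero_apply]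
    ring
  · simp only [grayTraceFree, h.nablaRicciCoord_space_space_time _ _ _ ht hx, grayA, grayB,
      h.ricciCoord_space_space_of_einstein hE hd _ _ ht hx, (h.isSymm_fibre x hx).apply i k, hmix,
      hpt, hps, h.eq_fromBlocks t ht x hx, Matrix.fromBlocks_apply₂₂,
      Matrix.fromBlocks_apply₂₁, Matrix.smul_apply, smul_eq_mul, hcard, Matrix.zero_apply]
    ring
  · simp [grayTraceFree, h.nablaRicciCoord_space_space_space hE hd _ _ _ ht hx, grayA, grayB, hps,
      h.eq_fromBlocks t ht x hx]

end IsWarpedProduct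

end WarpedSinyukov

/-! ### Product charts: from the manifold to warped product coordinates. -/

section Charts

variable {d : ℕ} {M : Type*} [TopologicalSpace M] [ChartedSpace (Fib d) M]

/-- The atlas of ℝ contains only the identity, so every chart of the space-time keeps t as its time
coordinate. -/
theorem exists_eq_prod_of_mem_atlas {e : OpenPartialHomeomorph (ℝ × M) (ModelProd ℝ (Fib d))}
    (he : e ∈ atlas (ModelProd ℝ (Fib d)) (ℝ × M)) :
    ∃ e' ∈ atlas (Fib d) M, e = (OpenPartialHomeomorph.refl ℝ).prod e' := by
  obtain ⟨e₁, h₁, e₂, h₂, rfl⟩ := he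
  rw [chartedSpaceSelf_atlas] at h₁
  exact ⟨e₂, h₂, by rw [h₁]⟩

theorem prod_mem_atlas {e : OpenPartialHomeomorph M (Fib d)} (he : e ∈ atlas (Fib d) M) :
    (OpenPartialHomeomorph.refl ℝ).prod e ∈ atlas (ModelProd ℝ (Fib d)) (ℝ × M) :=
  ⟨_, chartedSpaceSelf_atlas.2 rfl, e, he, rfl⟩

variable [IsManifold 𝓘(ℝ, Fib d) ∞ M]

/-- The components of the fibre metric in a chart. -/
noncomputable abbrev fibreInChart (gs : FibreMetric d M) (e : OpenPartialHomeomorph M (Fib d)) :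
    Fib d → Matrix (Fin d) (Fin d) ℝ :=
  metricInChart (fibBasis d) 𝓘(ℝ, Fib d) (fun x => gs.inner x) e

theorem contMDiffOn_mfderiv_symm {e : OpenPartialHomeomorph M (Fib d)} (he : e ∈ atlas (Fib d) M)
    (v : Fib d) :
    ContMDiffOn 𝓘(ℝ, Fib d) 𝓘(ℝ, Fib d).tangent ∞
      (fun y => (⟨e.symm y, mfderiv 𝓘(ℝ, Fib d) 𝓘(ℝ, Fib d) e.symm y v⟩ :
        TangentBundle 𝓘(ℝ, Fib d) M)) e.target := by
  have h1 := (contMDiffOn_symm_of_mem_maximalAtlas (I := 𝓘(ℝ, Fib d)) (n := ∞)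
    (IsManifold.subset_maximalAtlas he)).contMDiffOn_tangentMapWithin (m := ∞) (by simp)
      e.open_target.uniqueMDiffOn
  have h2 : ContMDiff 𝓘(ℝ, Fib d) 𝓘(ℝ, Fib d).tangent ∞
      (fun y : Fib d => (⟨y, v⟩ : TangentBundle 𝓘(ℝ, Fib d) (Fib d))) :=
    contMDiff_vectorSpace_iff_contDiff.2 contDiff_const
  refine (h1.comp h2.contMDiffOn fun y hy => hy).congr fun y hy => ?_
  simp only [Function.comp, tangentMapWithin]
  rw [mfderivWithin_of_isOpen e.open_target hy]

theorem contDiffOn_fibreInChart (gs : FibreMetric d M) {e : OpenPartialHomeomorph M (Fib d)}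
    (he : e ∈ atlas (Fib d) M) (i j : Fin d) :
    ContDiffOn ℝ ∞ (fun y => fibreInChart gs e y i j) e.target := by
  rw [← contMDiffOn_iff_contDiffOn]
  have hψ := gs.contMDiff.comp_contMDiffOn
    (contMDiffOn_symm_of_mem_maximalAtlas (I := 𝓘(ℝ, Fib d)) (n := ∞)
      (IsManifold.subset_maximalAtlas he))
  have h := ContMDiffOn.clm_bundle_apply₂ (F₃ := ℝ) (E₃ := Bundle.Trivial M ℝ) hψ
    (contMDiffOn_mfderiv_symm he (fibBasis d i)) (contMDiffOn_mfderiv_symm he (fibBasis d j))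
  intro y hy
  have h' := h y hy
  rw [Bundle.contMDiffWithinAt_totalSpace] at h'
  exact h'.2

/-- The components of a vector at a point of the chart domain. -/
noncomputable def chartComponents (e : OpenPartialHomeomorph M (Fib d)) (x : M)
    (v : TangentSpace 𝓘(ℝ, Fib d) x) : Fin d → ℝ :=
  fun i => (fibBasis d).repr (mfderiv 𝓘(ℝ, Fib d) 𝓘(ℝ, Fib d) e x v) i

theorem inner_mfderiv_symm (gs : FibreMetric d M) (e : OpenPartialHomeomorph M (Fib d))
    (y v w : Fib d) :
    gs.inner (e.symm y) (mfderiv 𝓘(ℝ, Fib d) 𝓘(ℝ, Fib d) e.symm y v)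
        (mfderiv 𝓘(ℝ, Fib d) 𝓘(ℝ, Fib d) e.symm y w)
      = ∑ i, ∑ j, fibreInChart gs e y i j * (fibBasis d).repr v i * (fibBasis d).repr w j := by
  have h : ∀ B : Fib d →L[ℝ] Fib d →L[ℝ] ℝ, B v w
      = ∑ i, ∑ j, B (fibBasis d i) (fibBasis d j) * (fibBasis d).repr v i
        * (fibBasis d).repr w j := fun B => by
    conv_lhs => rw [← (fibBasis d).sum_repr v, ← (fibBasis d).sum_repr w]
    simp only [map_sum, map_smul, sum_apply, smul_apply,
      smul_eq_mul, Finset.mul_sum]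
    rw [Finset.sum_comm]
    exact Finset.sum_congr rfl fun i _ => Finset.sum_congr rfl fun j _ => by ring
  let L : Fib d →L[ℝ] Fib d := mfderiv 𝓘(ℝ, Fib d) 𝓘(ℝ, Fib d) e.symm y
  let g : Fib d →L[ℝ] Fib d →L[ℝ] ℝ := gs.inner (e.symm y)
  exact h (g.bilinearComp L L)

theorem mfderiv_symm_mfderiv {e : OpenPartialHomeomorph M (Fib d)} (he : e ∈ atlas (Fib d) M)
    {x : M} (hx : x ∈ e.source) (v : Fib d) :
    (mfderiv 𝓘(ℝ, Fib d) 𝓘(ℝ, Fib d) e.symm (e x)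
      (mfderiv 𝓘(ℝ, Fib d) 𝓘(ℝ, Fib d) e x v) : Fib d) = v :=
  congrArg (fun L => L v)
    ((mdifferentiable_of_mem_atlas (I := 𝓘(ℝ, Fib d)) he).symm_comp_deriv hx)

theorem mfderiv_mfderiv_symm {e : OpenPartialHomeomorph M (Fib d)} (he : e ∈ atlas (Fib d) M)
    {y : Fib d} (hy : y ∈ e.target) (v : Fib d) :
    (mfderiv 𝓘(ℝ, Fib d) 𝓘(ℝ, Fib d) e (e.symm y)
      (mfderiv 𝓘(ℝ, Fib d) 𝓘(ℝ, Fib d) e.symm y v) : Fib d) = v :=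
  congrArg (fun L => L v)
    ((mdifferentiable_of_mem_atlas (I := 𝓘(ℝ, Fib d)) he).comp_symm_deriv hy)

theorem inner_eq_sum (gs : FibreMetric d M) {e : OpenPartialHomeomorph M (Fib d)}
    (he : e ∈ atlas (Fib d) M) {x : M} (hx : x ∈ e.source) (v w : TangentSpace 𝓘(ℝ, Fib d) x) :
    gs.inner x v w = ∑ i, ∑ j, fibreInChart gs e (e x) i j * chartComponents e x v i
      * chartComponents e x w j := by
  have h := inner_mfderiv_symm gs e (e x) (mfderiv 𝓘(ℝ, Fib d) 𝓘(ℝ, Fib d) e x v)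
    (mfderiv 𝓘(ℝ, Fib d) 𝓘(ℝ, Fib d) e x w)
  -- The point `e.symm (e x)` equals x only propositionally, so the metric is transported between
  -- the two base points.
  have hb : ∀ x', x' = x → ∀ v w : Fib d, gs.inner x' v w = gs.inner x v w := by
    rintro _ rfl _ _
    rfl
  exact (hb _ (e.left_inv hx) v w).symm.trans ((congrArg₂
    (fun p q : Fib d => (gs.inner (e.symm (e x)) p q : ℝ))
    (mfderiv_symm_mfderiv he hx v) (mfderiv_symm_mfderiv he hx w)).symm.trans h)

theorem exists_chartComponents_eq {e : OpenPartialHomeomorph M (Fib d)}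
    (he : e ∈ atlas (Fib d) M) {x : M} (hx : x ∈ e.source) (i : Fin d) :
    ∃ v : TangentSpace 𝓘(ℝ, Fib d) x, ∀ j, chartComponents e x v j = if i = j then 1 else 0 := by
  obtain ⟨y, hy, rfl⟩ : ∃ y ∈ e.target, e.symm y = x := ⟨e x, e.map_source hx, e.left_inv hx⟩
  refine ⟨mfderiv 𝓘(ℝ, Fib d) 𝓘(ℝ, Fib d) e.symm y (fibBasis d i), fun j => ?_⟩
  rw [chartComponents, mfderiv_mfderiv_symm he hy, Basis.repr_self, Finsupp.single_apply]

/-- A vector in the kernel of the matrix would give a tangent vector of length zero, so it vanishes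
by positive definiteness and injectivity of the chart derivative. -/
theorem isUnit_det_fibreInChart (gs : FibreMetric d M) {e : OpenPartialHomeomorph M (Fib d)}
    (he : e ∈ atlas (Fib d) M) {y : Fib d} (hy : y ∈ e.target) :
    IsUnit (fibreInChart gs e y).det := by
  rw [isUnit_iff_ne_zero]
  intro hdet
  obtain ⟨c, hc, hGc⟩ := Matrix.exists_mulVec_eq_zero_iff.2 hdet
  let v : Fib d := (fibBasis d).equivFun.symm c
  have hv : ∀ i, (fibBasis d).repr v i = c i := fun i => by
    rw [← Basis.equivFun_apply, LinearEquiv.apply_symm_apply]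
  have h0 : gs.inner (e.symm y) (mfderiv 𝓘(ℝ, Fib d) 𝓘(ℝ, Fib d) e.symm y v)
      (mfderiv 𝓘(ℝ, Fib d) 𝓘(ℝ, Fib d) e.symm y v) = 0 := by
    rw [inner_mfderiv_symm]
    refine Finset.sum_eq_zero fun i _ => ?_
    have hi := congrFun hGc i
    simp only [Matrix.mulVec, dotProduct, Pi.zero_apply] at hi
    simp only [hv, mul_right_comm _ (c i), ← Finset.sum_mul, hi, zero_mul]
  have hLv : (mfderiv 𝓘(ℝ, Fib d) 𝓘(ℝ, Fib d) e.symm y v : Fib d) = 0 := by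
    by_contra hne
    exact (gs.pos _ _ hne).ne' h0
  have hv0 : v = 0 := by
    rw [← mfderiv_mfderiv_symm he hy v, hLv]
    exact map_zero (mfderiv 𝓘(ℝ, Fib d) 𝓘(ℝ, Fib d) e (e.symm y))
  exact hc (funext fun i => by rw [← hv i, hv0]; simp)

theorem mfderiv_extend_prod {e : OpenPartialHomeomorph M (Fib d)} (he : e ∈ atlas (Fib d) M)
    {p : ℝ × M} (hp : p.2 ∈ e.source) (τ : ℝ) (v : Fib d) :
    (mfderiv (stModel d) 𝓘(ℝ, ℝ × Fib d)
      (((OpenPartialHomeomorph.refl ℝ).prod e).extend (stModel d)) p ((τ, v) : ℝ × Fib d) :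
        ℝ × Fib d)
      = (τ, mfderiv 𝓘(ℝ, Fib d) 𝓘(ℝ, Fib d) e p.2 v) := by
  have h1 : HasMFDerivAt (stModel d) 𝓘(ℝ, ℝ) (fun q : ℝ × M => q.1) p _ := hasMFDerivAt_fst p
  have h2 : HasMFDerivAt (stModel d) 𝓘(ℝ, Fib d) (fun q : ℝ × M => e q.2) p _ :=
    HasMFDerivAt.comp p (((mdifferentiable_of_mem_atlas (I := 𝓘(ℝ, Fib d))
      he).mdifferentiableAt hp).hasMFDerivAt) (hasMFDerivAt_snd p)
  have h3 : HasMFDerivAt (stModel d) 𝓘(ℝ, ℝ × Fib d)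
      (((OpenPartialHomeomorph.refl ℝ).prod e).extend (stModel d)) p _ :=
    ⟨h1.1.prodMk h2.1, h1.2.prodMk h2.2⟩
  rw [h3.mfderiv]
  rfl

theorem mfderiv_extend_symm_prod {e : OpenPartialHomeomorph M (Fib d)} (he : e ∈ atlas (Fib d) M)
    {t : ℝ} {y : Fib d} (hy : y ∈ e.target) (τ : ℝ) (v : Fib d) :
    (mfderiv 𝓘(ℝ, ℝ × Fib d) (stModel d)
      (((OpenPartialHomeomorph.refl ℝ).prod e).extend (stModel d)).symm (t, y)
        ((τ, v) : ℝ × Fib d) : ℝ × Fib d)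
      = (τ, mfderiv 𝓘(ℝ, Fib d) 𝓘(ℝ, Fib d) e.symm y v) := by
  have h1 : HasMFDerivAt 𝓘(ℝ, ℝ × Fib d) 𝓘(ℝ, ℝ) (fun q : ℝ × Fib d => q.1) (t, y) _ :=
    hasFDerivAt_fst.hasMFDerivAt
  have h2 : HasMFDerivAt 𝓘(ℝ, ℝ × Fib d) 𝓘(ℝ, Fib d) (fun q : ℝ × Fib d => e.symm q.2) (t, y) _ :=
    HasMFDerivAt.comp (t, y) (((mdifferentiable_of_mem_atlas (I := 𝓘(ℝ, Fib d))
      he).mdifferentiableAt_symm hy).hasMFDerivAt) hasFDerivAt_snd.hasMFDerivAt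
  have h3 : HasMFDerivAt 𝓘(ℝ, ℝ × Fib d) (stModel d)
      (((OpenPartialHomeomorph.refl ℝ).prod e).extend (stModel d)).symm (t, y) _ := h1.prodMk h2
  rw [h3.mfderiv]
  rfl

/-- The bridge to the manifold: it makes every coordinate formula above available in each chart of
the space-time. -/
theorem isWarpedProduct_metricInChart (gs : FibreMetric d M)
    {e : OpenPartialHomeomorph M (Fib d)} (he : e ∈ atlas (Fib d) M) {J : Set ℝ} (hJ : IsOpen J)
    {a : ℝ → ℝ} (ha : ContDiffOn ℝ ∞ a J) (hpos : ∀ t ∈ J, 0 < a t) :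
    IsWarpedProduct J a e.target (fibreInChart gs e)
      (metricInChart (stBasis d) (stModel d) (grwMetric a gs)
        ((OpenPartialHomeomorph.refl ℝ).prod e)) where
  isOpen_base := hJ
  isOpen_fibre := e.open_target
  contDiffOn_scale := ha
  scale_pos := hpos
  contDiffOn_fibre := contDiffOn_fibreInChart gs he
  isSymm_fibre x hx := Matrix.IsSymm.ext fun i j => gs.symm _ _ _
  isUnit_det_fibre x hx := isUnit_det_fibreInChart gs he hx
  eq_fromBlocks t ht y hy := by
    have h : ∀ i j, metricInChart (stBasis d) (stModel d) (grwMetric a gs)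
        ((OpenPartialHomeomorph.refl ℝ).prod e) (t, y) i j
        = -((stBasis d i).1 * (stBasis d j).1) + a t ^ 2 *
          gs.inner (e.symm y) (mfderiv 𝓘(ℝ, Fib d) 𝓘(ℝ, Fib d) e.symm y (stBasis d i).2)
            (mfderiv 𝓘(ℝ, Fib d) 𝓘(ℝ, Fib d) e.symm y (stBasis d j).2) := fun i j =>
      (congrArg₂ (fun u v : ℝ × Fib d => (grwMetric a gs (t, e.symm y) u v : ℝ))
        (mfderiv_extend_symm_prod he (t := t) hy (stBasis d i).1 (stBasis d i).2)
        (mfderiv_extend_symm_prod he (t := t) hy (stBasis d j).1 (stBasis d j).2)).trans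
      (grwMetric_apply a gs (t, e.symm y) _ _ _ _)
    ext i j
    rw [h, inner_mfderiv_symm]
    rcases i with i | i <;> rcases j with j | j <;>
    simp [stBasis_inl, stBasis_inr]

theorem contMDiff_comoving :
    ContMDiff (stModel d) (stModel d).tangent ∞
      (fun p : ℝ × M => (⟨p, comoving p⟩ : TangentBundle (stModel d) (ℝ × M))) := by
  have h1 : ContMDiff 𝓘(ℝ, ℝ) 𝓘(ℝ, ℝ).tangent ∞
      (fun t : ℝ => (⟨t, (1 : ℝ)⟩ : TangentBundle 𝓘(ℝ, ℝ) ℝ)) :=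
    contMDiff_vectorSpace_iff_contDiff.2 contDiff_const
  have h2 : ContMDiff 𝓘(ℝ, Fib d) 𝓘(ℝ, Fib d).tangent ∞
      (fun x : M => (⟨x, 0⟩ : TangentBundle 𝓘(ℝ, Fib d) M)) :=
    Bundle.contMDiff_zeroSection ℝ (TangentSpace 𝓘(ℝ, Fib d) (M := M))
  exact contMDiff_equivTangentBundleProd_symm.comp
    ((h1.comp contMDiff_fst).prodMk (h2.comp contMDiff_snd))

end Charts

/-! ### Functions of time: regularity, constancy and first integrals. -/

section Scale

variable {d : ℕ} {J : Set ℝ} {a : ℝ → ℝ}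

theorem contDiffOn_warpedEigenvalue (hJ : IsOpen J) (ha : ContDiffOn ℝ ∞ a J)
    (hpos : ∀ t ∈ J, 0 < a t) : ContDiffOn ℝ ∞ (warpedEigenvalue d a) J := by
  have h1 : ContDiffOn ℝ ∞ (deriv a) J := ha.deriv_of_isOpen hJ (by simp)
  have h2 : ContDiffOn ℝ ∞ (deriv (deriv a)) J := h1.deriv_of_isOpen hJ (by simp)
  exact contDiffOn_const.mul (h2.div ha fun t ht => (hpos t ht).ne')

theorem contDiffOn_warpedScalar (hJ : IsOpen J) (ha : ContDiffOn ℝ ∞ a J)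
    (hpos : ∀ t ∈ J, 0 < a t) (s : ℝ) : ContDiffOn ℝ ∞ (warpedScalar d a s) J := by
  have h1 : ContDiffOn ℝ ∞ (deriv a) J := ha.deriv_of_isOpen hJ (by simp)
  have h2 : ContDiffOn ℝ ∞ (deriv (deriv a)) J := h1.deriv_of_isOpen hJ (by simp)
  have hne : ∀ t ∈ J, a t ≠ 0 := fun t ht => (hpos t ht).ne'
  exact ((contDiffOn_const.mul (h2.div ha hne)).add
    (contDiffOn_const.mul ((h1.div ha hne).pow 2))).add
    (contDiffOn_const.div (ha.pow 2) fun t ht => pow_ne_zero 2 (hne t ht))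

theorem exists_eq_const_of_hasDerivAt_zero (hJ : IsOpen J) (hJc : J.OrdConnected) {f : ℝ → ℝ}
    (hf : ∀ t ∈ J, HasDerivAt f 0 t) : ∃ c, ∀ t ∈ J, f t = c :=
  hJ.exists_is_const_of_deriv_eq_zero hJc.isPreconnected
    (fun t ht => (hf t ht).differentiableAt.differentiableWithinAt) (fun t ht => (hf t ht).deriv)

theorem exists_deriv_ne_zero (hJ : IsOpen J) (hJc : J.OrdConnected) (ha : ContDiffOn ℝ ∞ a J)
    (hnc : ∃ s ∈ J, ∃ t ∈ J, a s ≠ a t) : ∃ t ∈ J, deriv a t ≠ 0 := by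
  by_contra! hcon
  obtain ⟨c, hc⟩ := exists_eq_const_of_hasDerivAt_zero hJ hJc (f := a) fun t ht => by
    rw [← hcon t ht]
    exact ((ha.contDiffAt (hJ.mem_nhds ht)).differentiableAt (by simp)).hasDerivAt
  obtain ⟨s, hs, t, ht, hst⟩ := hnc
  exact hst (by rw [hc s hs, hc t ht])

namespace IsWarpedProduct

variable {V : Set (Fib d)} {Gs : Fib d → Matrix (Fin d) (Fin d) ℝ}
  {G : ℝ × Fib d → Matrix (Unit ⊕ Fin d) (Unit ⊕ Fin d) ℝ}
  (h : IsWarpedProduct J a V Gs G)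
include h

/-- The fibre curvature enters R' only through -2 s a'/a³, which is injective in s where a' ≠ 0. -/
theorem eq_of_deriv_warpedScalar_eq {s s' t : ℝ} (ht : t ∈ J) (hda : deriv a t ≠ 0)
    (hs : deriv (warpedScalar d a s) t = deriv (warpedScalar d a s') t) : s = s' := by
  have ha := h.scale_ne_zero ht
  rw [(h.hasDerivAt_warpedScalar s ht).deriv, (h.hasDerivAt_warpedScalar s' ht).deriv,
    sub_right_inj] at hs
  field_simp at hs
  exact hs

/-- Integration of `(n + 2) ξ' = 2 R'`, with `n = d + 1`. -/
theorem exists_constants (hJc : J.OrdConnected) (hd : 2 < d) {s : ℝ}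
    (hode : ∀ t ∈ J, ((d : ℝ) + 3) * deriv (warpedEigenvalue d a) t
      = 2 * deriv (warpedScalar d a s) t) :
    ∃ α β : ℝ, ∀ t ∈ J,
      warpedScalar d a s t = α - β * (((d : ℝ) + 3) / ((d : ℝ) - 1)) * a t ^ 2 ∧
      warpedEigenvalue d a t = α / (d + 1) - β * (2 / ((d : ℝ) - 1)) * a t ^ 2 := by
  have hd2 : (2 : ℝ) < d := by exact_mod_cast hd
  have hd1 : (d : ℝ) - 1 ≠ 0 := by linarith
  have hd1' : (d : ℝ) + 1 ≠ 0 := by linarith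
  have hξ := fun t (ht : t ∈ J) => (h.hasDerivAt_warpedEigenvalue ht).differentiableAt.hasDerivAt
  have hS := fun t (ht : t ∈ J) => (h.hasDerivAt_warpedScalar s ht).differentiableAt.hasDerivAt
  obtain ⟨p, hp⟩ := exists_eq_const_of_hasDerivAt_zero h.isOpen_base hJc
    (f := fun t => ((d : ℝ) + 3) * warpedEigenvalue d a t - 2 * warpedScalar d a s t)
    fun t ht => (((hξ t ht).const_mul _).fun_sub ((hS t ht).const_mul _)).congr_deriv
      (by rw [hode t ht, sub_self])
  -- With (n + 2) ξ' = 2 R', the Bianchi identity becomes X' = 2HX for X = nξ - R, so X/a² is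
  -- constant.
  obtain ⟨q, hq⟩ := exists_eq_const_of_hasDerivAt_zero h.isOpen_base hJc
    (f := fun t => (((d : ℝ) + 1) * warpedEigenvalue d a t - warpedScalar d a s t) / a t ^ 2)
    fun t ht => by
      have ha := h.scale_ne_zero ht
      refine ((((hξ t ht).const_mul _).fun_sub (hS t ht)).fun_div
        ((h.hasDerivAt_scale ht).fun_pow 2) (pow_ne_zero 2 ha)).congr_deriv ?_
      have hB := h.deriv_warpedScalar_sub s ht
      have hB' : a t * (deriv (warpedScalar d a s) t - 2 * deriv (warpedEigenvalue d a) t)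
          = 2 * deriv a t * ((d + 1) * warpedEigenvalue d a t - warpedScalar d a s t) := by
        rw [hB]
        field_simp
      rw [div_eq_zero_iff]
      left
      simp only [Nat.cast_ofNat, Nat.add_one_sub_one, pow_one]
      linear_combination (a t) ^ 2 * hode t ht + a t * hB'
  -- These come from solving (d + 3) ξ - 2R = p and (d + 1) ξ - R = q a² for ξ and R; the
  -- determinant is d - 1.
  refine ⟨-p * (d + 1) / (d - 1), -q, fun t ht => ?_⟩
  have h1 := hp t ht
  have h2 := hq t ht
  have ha := h.scale_ne_zero ht
  rw [div_eq_iff (pow_ne_zero 2 ha)] at h2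
  constructor
  · field_simp
    linear_combination (d + 3) * h2 - (d + 1) * h1
  · field_simp
    linear_combination 2 * h2 - h1

end IsWarpedProduct

end Scale

/-! ### The Ricci tensor of the space-time on tangent vectors. -/

section Spacetime

variable {d : ℕ} {M : Type*} [TopologicalSpace M] [ChartedSpace (Fib d) M]
  [IsManifold 𝓘(ℝ, Fib d) ∞ M] {gs : FibreMetric d M} {a : ℝ → ℝ} {J : Set ℝ}
  {e : OpenPartialHomeomorph M (Fib d)} {t : ℝ} {x : M}

theorem ricciTensor_grwMetric (he : e ∈ atlas (Fib d) M)
    (hJ : IsOpen J) (ha : ContDiffOn ℝ ∞ a J) (hpos : ∀ t ∈ J, 0 < a t)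
    (ht : t ∈ J) (hx : x ∈ e.source) (τ σ : ℝ) (v w : Fib d) :
    ricciTensor (stBasis d) (stModel d) (grwMetric a gs) ((OpenPartialHomeomorph.refl ℝ).prod e)
        (t, x) ((τ, v) : ℝ × Fib d) ((σ, w) : ℝ × Fib d)
      = -warpedEigenvalue d a t * τ * σ
        + ∑ i, ∑ j, ricciCoord (stBasis d)
            (metricInChart (stBasis d) (stModel d) (grwMetric a gs)
              ((OpenPartialHomeomorph.refl ℝ).prod e)) (Sum.inr i) (Sum.inr j) (t, e x)
          * chartComponents e x v i * chartComponents e x w j := by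
  have h := isWarpedProduct_metricInChart gs he hJ ha hpos
  have hy := e.map_source hx
  have hp : (((OpenPartialHomeomorph.refl ℝ).prod e).extend (stModel d)) (t, x) = (t, e x) := rfl
  have hr : ∀ (τ : ℝ) (v : Fib d), ((stBasis d).repr (mfderiv (stModel d) 𝓘(ℝ, ℝ × Fib d)
      (((OpenPartialHomeomorph.refl ℝ).prod e).extend (stModel d)) (t, x)
        ((τ, v) : ℝ × Fib d)) : Unit ⊕ Fin d → ℝ)
      = Sum.elim (fun _ => τ) (chartComponents e x v) := fun τ v => by
    have h1 := congrArg (fun u => ((stBasis d).repr u : Unit ⊕ Fin d → ℝ))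
      (mfderiv_extend_prod he (p := (t, x)) hx τ v)
    refine h1.trans (funext fun i => ?_)
    rcases i with i | i
    · exact stBasis_repr_inl _ i
    · exact stBasis_repr_inr _ i
  simp only [ricciTensor, hp]
  rw [hr, hr]
  simp only [Fintype.sum_sum_type, h.ricciCoord_time_time _ _ ht hy,
    h.ricciCoord_time_space _ _ ht hy, h.ricciCoord_space_time _ _ ht hy, Sum.elim_inl,
    Sum.elim_inr, zero_mul, Finset.sum_const_zero, add_zero, zero_add, Finset.univ_unique,
    Finset.sum_singleton]
  rfl

end Spacetime

/-! ### Both conditions reduce to an Einstein fibre and (n + 2) ξ' = 2 R'. -/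

section GRWSpacetime

variable {d : ℕ} {M : Type*} [TopologicalSpace M] [ChartedSpace (Fib d) M]
  [IsManifold 𝓘(ℝ, Fib d) ∞ M] (gs : FibreMetric d M) {a : ℝ → ℝ} {J : Set ℝ}
  {e : OpenPartialHomeomorph M (Fib d)}

omit [IsManifold 𝓘(ℝ, Fib d) ∞ M] in
theorem chartComponents_zero (x : M) (i : Fin d) : chartComponents e x (0 : Fib d) i = 0 := by
  have h : ∀ L : Fib d →L[ℝ] Fib d, (fibBasis d).repr (L 0) i = 0 := fun L => by simp
  exact h (mfderiv 𝓘(ℝ, Fib d) 𝓘(ℝ, Fib d) e x)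

theorem inner_zero_left (x : M) (w : Fib d) : gs.inner x (0 : Fib d) w = 0 := by
  have h : ∀ g : Fib d →L[ℝ] Fib d →L[ℝ] ℝ, g 0 w = 0 := fun g => by simp
  exact h (gs.inner x)

theorem inner_zero_right (x : M) (w : Fib d) : gs.inner x w (0 : Fib d) = 0 :=
  (gs.symm x w _).trans (inner_zero_left gs x w)

theorem inner_self_nonneg (x : M) (w : Fib d) : 0 ≤ gs.inner x w w := by
  by_cases hw : w = 0
  · rw [hw, inner_zero_left]
  · exact (gs.pos x w hw).le

theorem grwMetric_comoving (p : ℝ × M) (τ : ℝ) (v : Fib d) :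
    grwMetric a gs p (comoving p) ((τ, v) : ℝ × Fib d) = -τ :=
  (grwMetric_apply a gs p 1 τ 0 v).trans (by rw [inner_zero_left]; ring)

/-- The fibre is Einstein with constant `c`, and `(n + 2) ξ' = 2 R'` holds on `J`. -/
def IsEinsteinSinyukov (gs : FibreMetric d M) (a : ℝ → ℝ) (J : Set ℝ) (c : ℝ) : Prop :=
  ∀ e ∈ atlas (Fib d) M, ∀ y ∈ e.target,
    (∀ i j, ricciCoord (fibBasis d) (fibreInChart gs e) i j y = c * fibreInChart gs e y i j) ∧
    ∀ t ∈ J, ((d : ℝ) + 3) * deriv (warpedEigenvalue d a) t = 2 * deriv (warpedScalar d a (d * c)) t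

variable (hJ : IsOpen J) (ha : ContDiffOn ℝ ∞ a J) (hpos : ∀ t ∈ J, 0 < a t)
include hJ ha hpos

/-- `ξ'` and `R'` determine the scalar curvature of the fibre at a time where `a' ≠ 0`, so
pointwise Einstein constants of the fibre agree everywhere. -/
theorem exists_isEinsteinSinyukov (hd : 0 < d) {t₀ : ℝ} (ht₀ : t₀ ∈ J) (hda : deriv a t₀ ≠ 0)
    (hE : ∀ e ∈ atlas (Fib d) M, ∀ y ∈ e.target, ∃ c : ℝ, ∀ i j,
      ricciCoord (fibBasis d) (fibreInChart gs e) i j y = c * fibreInChart gs e y i j)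
    (hode : ∀ e ∈ atlas (Fib d) M, ∀ y ∈ e.target, ∀ t ∈ J,
      ((d : ℝ) + 3) * deriv (warpedEigenvalue d a) t
        = 2 * deriv (warpedScalar d a (scalarCoord (fibBasis d) (fibreInChart gs e) y)) t) :
    ∃ c, IsEinsteinSinyukov gs a J c := by
  have hd' : (d : ℝ) ≠ 0 := by positivity
  -- If no chart has a point, the condition is vacuous and any constant serves.
  by_cases hne : ∃ e ∈ atlas (Fib d) M, ∃ y, y ∈ e.target
  · obtain ⟨e₀, he₀, y₀, hy₀⟩ := hne
    have h₀ := isWarpedProduct_metricInChart gs he₀ hJ ha hpos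
    obtain ⟨c, hc⟩ := hE e₀ he₀ y₀ hy₀
    have ho₀ := hode e₀ he₀ y₀ hy₀
    rw [h₀.scalarCoord_fibre_of_einstein hy₀ hc] at ho₀
    refine ⟨c, fun e he y hy => ⟨?_, ho₀⟩⟩
    have h := isWarpedProduct_metricInChart gs he hJ ha hpos
    obtain ⟨c', hc'⟩ := hE e he y hy
    have ho := hode e he y hy
    rw [h.scalarCoord_fibre_of_einstein hy hc'] at ho
    have heq := h.eq_of_deriv_warpedScalar_eq ht₀ hda
      (mul_left_cancel₀ two_ne_zero ((ho t₀ ht₀).symm.trans (ho₀ t₀ ht₀)))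
    rwa [mul_left_cancel₀ hd' heq] at hc'
  · exact ⟨0, fun e he y hy => (hne ⟨e, he, y, hy⟩).elim⟩

theorem ricciEigenvalue_eq (he : e ∈ atlas (Fib d) M) {t : ℝ} (ht : t ∈ J) {x : M}
    (hx : x ∈ e.source) :
    ricciEigenvalue a gs ((OpenPartialHomeomorph.refl ℝ).prod e) (t, x)
      = warpedEigenvalue d a t := by
  have h := ricciTensor_grwMetric (gs := gs) he hJ ha hpos ht hx 1 1 0 0
  simp only [chartComponents_zero, mul_zero, Finset.sum_const_zero, add_zero, mul_one] at h
  rw [ricciEigenvalue]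
  exact neg_eq_iff_eq_neg.2 h

theorem scalarR_eq (he : e ∈ atlas (Fib d) M) {t : ℝ} (ht : t ∈ J) {x : M}
    (hx : x ∈ e.source) :
    scalarR a gs ((OpenPartialHomeomorph.refl ℝ).prod e) (t, x)
      = warpedScalar d a (scalarCoord (fibBasis d) (fibreInChart gs e) (e x)) t :=
  (isWarpedProduct_metricInChart gs he hJ ha hpos).scalarCoord_eq ht (e.map_source hx)

theorem dot_ricciEigenvalue (he : e ∈ atlas (Fib d) M) {t : ℝ} (ht : t ∈ J) {x : M}
    (hx : x ∈ e.source) :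
    dot (ricciEigenvalue a gs ((OpenPartialHomeomorph.refl ℝ).prod e)) (t, x)
      = deriv (warpedEigenvalue d a) t :=
  Filter.EventuallyEq.deriv_eq (Filter.eventuallyEq_of_mem (hJ.mem_nhds ht)
    fun _ hs => ricciEigenvalue_eq gs hJ ha hpos he hs hx)

theorem dot_scalarR (he : e ∈ atlas (Fib d) M) {t : ℝ} (ht : t ∈ J) {x : M}
    (hx : x ∈ e.source) :
    dot (scalarR a gs ((OpenPartialHomeomorph.refl ℝ).prod e)) (t, x)
      = deriv (warpedScalar d a (scalarCoord (fibBasis d) (fibreInChart gs e) (e x))) t :=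
  Filter.EventuallyEq.deriv_eq (Filter.eventuallyEq_of_mem (hJ.mem_nhds ht)
    fun _ hs => scalarR_eq gs hJ ha hpos he hs hx)

/-- The velocity is an eigenvector of the Ricci tensor. -/
theorem ricciTensor_comoving (he : e ∈ atlas (Fib d) M) {p : ℝ × M} (ht : p.1 ∈ J)
    (hx : p.2 ∈ e.source) (w : TangentSpace (stModel d) p) :
    ricciTensor (stBasis d) (stModel d) (grwMetric a gs) ((OpenPartialHomeomorph.refl ℝ).prod e) p
        (comoving p) w
      = ricciEigenvalue a gs ((OpenPartialHomeomorph.refl ℝ).prod e) p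
        * grwMetric a gs p (comoving p) w := by
  obtain ⟨t, x⟩ := p
  obtain ⟨σ, w⟩ : ℝ × Fib d := w
  rw [ricciEigenvalue_eq gs hJ ha hpos he ht hx]
  have h := ricciTensor_grwMetric (gs := gs) he hJ ha hpos ht hx 1 σ 0 w
  simp only [chartComponents_zero, mul_zero, zero_mul, Finset.sum_const_zero, add_zero, mul_one] at h
  refine h.trans (Eq.trans ?_ (congrArg (fun r => warpedEigenvalue d a t * r)
    (grwMetric_comoving gs (t, x) σ w)).symm)
  ring

/-- The Ricci tensor over an Einstein fibre. -/
theorem ricciTensor_eq_of_isEinsteinSinyukov (hd : 0 < d) {c : ℝ}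
    (hc : IsEinsteinSinyukov gs a J c) (he : e ∈ atlas (Fib d) M) {p : ℝ × M} (ht : p.1 ∈ J)
    (hx : p.2 ∈ e.source) (w z : TangentSpace (stModel d) p) :
    ricciTensor (stBasis d) (stModel d) (grwMetric a gs) ((OpenPartialHomeomorph.refl ℝ).prod e)
        p w z
      = (warpedScalar d a (d * c) p.1 - warpedEigenvalue d a p.1) / d * grwMetric a gs p w z
        + ((warpedScalar d a (d * c) p.1 - warpedEigenvalue d a p.1) / d
            - warpedEigenvalue d a p.1)
          * grwMetric a gs p (comoving p) w * grwMetric a gs p (comoving p) z := by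
  obtain ⟨t, x⟩ := p
  obtain ⟨τ, v⟩ : ℝ × Fib d := w
  obtain ⟨σ, w⟩ : ℝ × Fib d := z
  have h := isWarpedProduct_metricInChart gs he hJ ha hpos
  have hric := ricciTensor_grwMetric (gs := gs) he hJ ha hpos ht hx τ σ v w
  simp only [h.ricciCoord_space_space_of_einstein (fun y hy => (hc e he y hy).1) hd _ _ ht
    (e.map_source hx)] at hric
  refine hric.trans ?_
  rw [grwMetric_comoving, grwMetric_comoving]
  refine Eq.trans ?_ (congrArg (fun r =>
    (warpedScalar d a (d * c) t - warpedEigenvalue d a t) / d * r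
      + ((warpedScalar d a (d * c) t - warpedEigenvalue d a t) / d - warpedEigenvalue d a t)
          * -τ * -σ) (grwMetric_apply a gs (t, x) τ σ v w)).symm
  simp only [inner_eq_sum gs he hx v w, mul_add, Finset.mul_sum]
  have hs : ∀ i j, a t ^ 2 * ((warpedScalar d a (d * c) t - warpedEigenvalue d a t) / d)
      * fibreInChart gs e (e x) i j * chartComponents e x v i * chartComponents e x w j
      = (warpedScalar d a (d * c) t - warpedEigenvalue d a t) / d
        * (a t ^ 2 * (fibreInChart gs e (e x) i j * chartComponents e x v i
          * chartComponents e x w j)) := fun i j => by ring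
  simp only [hs]
  ring

theorem isPerfectFluid_of_isEinsteinSinyukov (hd : 0 < d) {c : ℝ}
    (hc : IsEinsteinSinyukov gs a J c) :
    IsPerfectFluid (stBasis d) (stModel d) (grwMetric a gs) (J ×ˢ (univ : Set M)) := by
  have hξ := contDiffOn_warpedEigenvalue (d := d) hJ ha hpos
  have hS := contDiffOn_warpedScalar (d := d) hJ ha hpos (d * c)
  have hfst : ∀ {f : ℝ → ℝ}, ContDiffOn ℝ ∞ f J →
      ContMDiffOn (stModel d) 𝓘(ℝ, ℝ) ∞ (fun p : ℝ × M => f p.1) (J ×ˢ (univ : Set M)) :=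
    fun hf => (contMDiffOn_iff_contDiffOn.2 hf).comp contMDiffOn_fst fun p hp => hp.1
  refine ⟨fun p => (warpedScalar d a (d * c) p.1 - warpedEigenvalue d a p.1) / d,
    fun p => (warpedScalar d a (d * c) p.1 - warpedEigenvalue d a p.1) / d
      - warpedEigenvalue d a p.1, comoving,
    hfst ((hS.sub hξ).div_const _), hfst (((hS.sub hξ).div_const _).sub hξ),
    contMDiff_comoving.contMDiffOn, fun p _ => ?_, fun e he p hp w z => ?_⟩
  · exact grwMetric_comoving gs p 1 0
  · obtain ⟨e', he', rfl⟩ := exists_eq_prod_of_mem_atlas he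
    exact ricciTensor_eq_of_isEinsteinSinyukov gs hJ ha hpos hd hc he' hp.2.1 hp.1.2 w z

theorem inGrayI_of_isEinsteinSinyukov (hd : 0 < d) {c : ℝ} (hc : IsEinsteinSinyukov gs a J c) :
    InGrayI (stBasis d) (stModel d) (grwMetric a gs) (J ×ˢ (univ : Set M)) := by
  intro e he p hp j k l
  obtain ⟨e', he', rfl⟩ := exists_eq_prod_of_mem_atlas he
  exact (isWarpedProduct_metricInChart gs he' hJ ha hpos).grayTraceFree_eq_zero_of_einstein
    (fun y hy => (hc e' he' y hy).1) hd hp.2.1 (e'.map_source hp.1.2)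
    ((hc e' he' _ (e'.map_source hp.1.2)).2 _ hp.2.1) j k l

theorem exists_isEinsteinSinyukov_of_inGrayI (hd : 0 < d) {t₀ : ℝ} (ht₀ : t₀ ∈ J)
    (hda : deriv a t₀ ≠ 0)
    (hgray : InGrayI (stBasis d) (stModel d) (grwMetric a gs) (J ×ˢ (univ : Set M))) :
    ∃ c, IsEinsteinSinyukov gs a J c := by
  have hg : ∀ e ∈ atlas (Fib d) M, ∀ y ∈ e.target, ∀ t ∈ J, ∀ j k l,
      grayTraceFree (stBasis d) (metricInChart (stBasis d) (stModel d) (grwMetric a gs)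
        ((OpenPartialHomeomorph.refl ℝ).prod e)) j k l (t, y) = 0 := fun e he y hy t ht j k l => by
    have h := hgray _ (prod_mem_atlas he) (t, e.symm y)
      ⟨⟨mem_univ _, e.map_target hy⟩, ht, mem_univ _⟩ j k l
    have hp : (((OpenPartialHomeomorph.refl ℝ).prod e).extend (stModel d)) (t, e.symm y)
        = (t, e (e.symm y)) := rfl
    rwa [hp, e.right_inv hy] at h
  refine exists_isEinsteinSinyukov gs hJ ha hpos hd ht₀ hda (fun e he y hy => ?_)
    fun e he y hy t ht => ?_
  · exact (isWarpedProduct_metricInChart gs he hJ ha hpos).ricciCoord_fibre_of_grayTraceFree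
      ht₀ hy hda fun i j => hg e he y hy t₀ ht₀ _ _ _
  · have h := (isWarpedProduct_metricInChart gs he hJ ha hpos).grayTraceFree_time_time_time hd
      () () () ht hy
    rw [hg e he y hy t ht] at h
    have hd3 : (d : ℝ) + 3 ≠ 0 := by positivity
    field_simp at h
    linarith

/-- The fluid velocity v is not assumed to be u. Comparing the fluid form of Ric(u, w) with its
vanishing for spatial w gives B g(v, w) = 0, so either B = 0 or v is parallel to u at the point;
both make Ric a multiple of g on spatial vectors. -/
theorem exists_isEinsteinSinyukov_of_isPerfectFluid (hd : 0 < d) {t₀ : ℝ} (ht₀ : t₀ ∈ J)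
    (hda : deriv a t₀ ≠ 0)
    (hfluid : IsPerfectFluid (stBasis d) (stModel d) (grwMetric a gs) (J ×ˢ (univ : Set M)))
    (hode : ∀ e ∈ atlas (ModelProd ℝ (Fib d)) (ℝ × M), ∀ p ∈ e.source ∩ J ×ˢ (univ : Set M),
      ((d : ℝ) + 3) * dot (ricciEigenvalue a gs e) p = 2 * dot (scalarR a gs e) p) :
    ∃ c, IsEinsteinSinyukov gs a J c := by
  obtain ⟨A, B, u, -, -, -, hu, hric⟩ := hfluid
  refine exists_isEinsteinSinyukov gs hJ ha hpos hd ht₀ hda (fun e he y hy => ?_)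
    fun e he y hy t ht => ?_
  · obtain ⟨x, hx, rfl⟩ : ∃ x ∈ e.source, e x = y := ⟨e.symm y, e.map_target hy, e.right_inv hy⟩
    have hmem : (t₀, x) ∈ ((OpenPartialHomeomorph.refl ℝ).prod e).source ∩ J ×ˢ (univ : Set M) :=
      ⟨⟨mem_univ _, hx⟩, ht₀, mem_univ _⟩
    have h := isWarpedProduct_metricInChart gs he hJ ha hpos
    have ha0 := h.scale_ne_zero ht₀
    have hric' := hric _ (prod_mem_atlas he) (t₀, x) hmem
    have hunit := hu (t₀, x) hmem.2
    have hR := ricciTensor_comoving gs hJ ha hpos he (p := (t₀, x)) ht₀ hx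
    set U : ℝ × Fib d := u (t₀, x)
    have hUU : -(U.1 * U.1) + a t₀ ^ 2 * gs.inner x U.2 U.2 = -1 :=
      (grwMetric_apply a gs (t₀, x) U.1 U.1 U.2 U.2).symm.trans hunit
    -- Without a time component, v would have nonnegative square length instead of -1.
    have hU1 : U.1 ≠ 0 := fun h0 => by
      have := mul_nonneg (sq_nonneg (a t₀)) (inner_self_nonneg gs x U.2)
      rw [h0] at hUU
      linarith
    have hgU : ∀ w : Fib d, grwMetric a gs (t₀, x) U ((0, w) : ℝ × Fib d)
        = a t₀ ^ 2 * gs.inner x U.2 w := fun w =>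
      (grwMetric_apply a gs (t₀, x) U.1 0 U.2 w).trans (by ring)
    have hgu : grwMetric a gs (t₀, x) U (comoving (t₀, x)) = -U.1 :=
      (grwMetric_apply a gs (t₀, x) U.1 1 U.2 0).trans
        ((congrArg (fun r => -(U.1 * 1) + a t₀ ^ 2 * r) (inner_zero_right gs x U.2)).trans (by ring))
    have hBU : ∀ w : Fib d, B (t₀, x) * (a t₀ ^ 2 * gs.inner x U.2 w) = 0 := fun w => by
      have h1 := (hric' (comoving (t₀, x)) ((0, w) : ℝ × Fib d)).symm.trans
        (hR ((0, w) : ℝ × Fib d))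
      rw [grwMetric_comoving] at h1
      have h2 : B (t₀, x) * -U.1 * (a t₀ ^ 2 * gs.inner x U.2 w) = 0 := by
        rw [← hgu, ← hgU]
        simpa using h1
      have h3 : -U.1 * (B (t₀, x) * (a t₀ ^ 2 * gs.inner x U.2 w)) = 0 := by linarith
      exact (mul_eq_zero.1 h3).resolve_left (neg_ne_zero.2 hU1)
    have hspace : ∀ v w : Fib d, ricciTensor (stBasis d) (stModel d) (grwMetric a gs)
        ((OpenPartialHomeomorph.refl ℝ).prod e) (t₀, x) ((0, v) : ℝ × Fib d)
        ((0, w) : ℝ × Fib d) = A (t₀, x) * (a t₀ ^ 2 * gs.inner x v w) := fun v w => by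
      refine (hric' ((0, v) : ℝ × Fib d) ((0, w) : ℝ × Fib d)).trans ?_
      have hvw := grwMetric_apply a gs (t₀, x) 0 0 v w
      refine (congrArg₂ (fun r s => A (t₀, x) * r + B (t₀, x) * s *
        grwMetric a gs (t₀, x) U ((0, w) : ℝ × Fib d)) hvw (hgU v)).trans ?_
      simp only [hBU]
      ring
    -- Obtained from R_ij = A a² g*_ij by subtracting the warping contribution to the spatial Ricci
    -- tensor.
    refine ⟨A (t₀, x) * a t₀ ^ 2 - (a t₀ * deriv (deriv a) t₀ + (d - 1) * deriv a t₀ ^ 2),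
      fun i j => ?_⟩
    obtain ⟨v, hv⟩ := exists_chartComponents_eq he hx i
    obtain ⟨w, hw⟩ := exists_chartComponents_eq he hx j
    have h1 := (ricciTensor_grwMetric (gs := gs) he hJ ha hpos ht₀ hx 0 0 v w).symm.trans
      (hspace v w)
    have h2 := inner_eq_sum gs he hx v w
    simp only [hv, hw, mul_ite, mul_one, mul_zero, Finset.sum_ite_eq, Finset.mem_univ, if_true,
      zero_add] at h1 h2
    rw [h2, h.ricciCoord_space_space i j ht₀ hy] at h1
    linear_combination h1
  · have h := hode _ (prod_mem_atlas he) (t, e.symm y)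
      ⟨⟨mem_univ _, e.map_target hy⟩, ht, mem_univ _⟩
    rwa [dot_ricciEigenvalue gs hJ ha hpos he ht (e.map_target hy),
      dot_scalarR gs hJ ha hpos he ht (e.map_target hy), e.right_inv hy] at h

/-- The characterization for a GRW space-time of dimension `ν = d + 1`. -/
theorem grw_inGrayI_iff (hd : 2 < d) {ν : ℝ} (hν : ν = d + 1) (hJc : J.OrdConnected)
    (hanc : ∃ s ∈ J, ∃ t ∈ J, a s ≠ a t) :
    (InGrayI (stBasis d) (stModel d) (grwMetric a gs) (J ×ˢ (univ : Set M)) ↔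
      IsPerfectFluid (stBasis d) (stModel d) (grwMetric a gs) (J ×ˢ (univ : Set M)) ∧
      ∀ e ∈ atlas (ModelProd ℝ (Fib d)) (ℝ × M), ∀ p ∈ e.source ∩ J ×ˢ (univ : Set M),
        (ν + 2) * dot (ricciEigenvalue a gs e) p = 2 * dot (scalarR a gs e) p) ∧
    (InGrayI (stBasis d) (stModel d) (grwMetric a gs) (J ×ˢ (univ : Set M)) →
      ∃ α β : ℝ, ∀ e ∈ atlas (ModelProd ℝ (Fib d)) (ℝ × M),
        ∀ t ∈ J, ∀ x : M, (t, x) ∈ e.source →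
          scalarR a gs e (t, x) = α - β * ((ν + 2) / (ν - 2)) * a t ^ 2 ∧
          ricciEigenvalue a gs e (t, x) = α / ν - β * (2 / (ν - 2)) * a t ^ 2) := by
  have hd0 : 0 < d := by omega
  obtain ⟨t₀, ht₀, hda⟩ := exists_deriv_ne_zero hJ hJc ha hanc
  have e1 : ν + 2 = d + 3 := by rw [hν]; ring
  have e2 : ν - 2 = d - 1 := by rw [hν]; ring
  rw [e1, e2, hν]
  have hscal : ∀ {c : ℝ}, IsEinsteinSinyukov gs a J c → ∀ {e : OpenPartialHomeomorph M (Fib d)},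
      e ∈ atlas (Fib d) M → ∀ {x : M}, x ∈ e.source →
      scalarCoord (fibBasis d) (fibreInChart gs e) (e x) = d * c := fun hc e he x hx =>
    (isWarpedProduct_metricInChart gs he hJ ha hpos).scalarCoord_fibre_of_einstein
      (e.map_source hx) (hc e he _ (e.map_source hx)).1
  refine ⟨⟨fun hgray => ?_, fun hfluid => ?_⟩, fun hgray => ?_⟩
  · obtain ⟨c, hc⟩ := exists_isEinsteinSinyukov_of_inGrayI gs hJ ha hpos hd0 ht₀ hda hgray
    refine ⟨isPerfectFluid_of_isEinsteinSinyukov gs hJ ha hpos hd0 hc, ?_⟩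
    rintro e he ⟨t, x⟩ ⟨hx, ht⟩
    obtain ⟨e', he', rfl⟩ := exists_eq_prod_of_mem_atlas he
    rw [dot_ricciEigenvalue gs hJ ha hpos he' ht.1 hx.2,
      dot_scalarR gs hJ ha hpos he' ht.1 hx.2, hscal hc he' hx.2]
    exact (hc e' he' _ (e'.map_source hx.2)).2 t ht.1
  · obtain ⟨c, hc⟩ := exists_isEinsteinSinyukov_of_isPerfectFluid gs hJ ha hpos hd0 ht₀ hda
      hfluid.1 hfluid.2
    exact inGrayI_of_isEinsteinSinyukov gs hJ ha hpos hd0 hc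
  · obtain ⟨c, hc⟩ := exists_isEinsteinSinyukov_of_inGrayI gs hJ ha hpos hd0 ht₀ hda hgray
    by_cases hne : Nonempty M
    · obtain ⟨x₀⟩ := hne
      -- One chart suffices to find α and β: by `hscal` the fibre curvature is d c in every chart,
      -- so R and ξ are the same functions of t everywhere.
      have hx₀ := mem_chart_source (Fib d) x₀
      have he₀ := chart_mem_atlas (Fib d) x₀
      obtain ⟨α, β, hαβ⟩ := (isWarpedProduct_metricInChart gs he₀ hJ ha hpos).exists_constants
        hJc hd (hc _ he₀ _ ((chartAt (Fib d) x₀).map_source hx₀)).2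
      refine ⟨α, β, fun e he t ht x hx => ?_⟩
      obtain ⟨e', he', rfl⟩ := exists_eq_prod_of_mem_atlas he
      rw [scalarR_eq gs hJ ha hpos he' ht hx.2, ricciEigenvalue_eq gs hJ ha hpos he' ht hx.2,
        hscal hc he' hx.2]
      exact hαβ t ht
    · exact ⟨0, 0, fun _ _ _ _ x => (hne ⟨x⟩).elim⟩

end GRWSpacetime

end GRW

theorem mainTheorem4 (n : ℕ) (hn : 3 < n)
    {M : Type*} [TopologicalSpace M] [ChartedSpace (GRW.Fib (n - 1)) M]
    [IsManifold 𝓘(ℝ, GRW.Fib (n - 1)) ∞ M]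
    (gs : GRW.FibreMetric (n - 1) M)
    (J : Set ℝ) (hJopen : IsOpen J) (hJint : J.OrdConnected)
    (a : ℝ → ℝ) (ha : ContDiffOn ℝ ∞ a J) (hapos : ∀ t ∈ J, 0 < a t)
    (hanc : ∃ s ∈ J, ∃ t ∈ J, a s ≠ a t) :
    -- `u` is an eigenvector of the Ricci tensor, with eigenvalue `ξ`
    (∀ e ∈ atlas (ModelProd ℝ (GRW.Fib (n - 1))) (ℝ × M),
      ∀ p ∈ e.source ∩ J ×ˢ (univ : Set M),
      ∀ w : TangentSpace (GRW.stModel (n - 1)) p,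
        GRW.ricciTensor (GRW.stBasis (n - 1)) (GRW.stModel (n - 1)) (GRW.grwMetric a gs) e p
            (GRW.comoving p) w
          = GRW.ricciEigenvalue a gs e p * GRW.grwMetric a gs p (GRW.comoving p) w) ∧
    -- the characterization of the subspace
    (GRW.InGrayI (GRW.stBasis (n - 1)) (GRW.stModel (n - 1)) (GRW.grwMetric a gs)
        (J ×ˢ (univ : Set M)) ↔
      GRW.IsPerfectFluid (GRW.stBasis (n - 1)) (GRW.stModel (n - 1)) (GRW.grwMetric a gs)
        (J ×ˢ (univ : Set M)) ∧
      ∀ e ∈ atlas (ModelProd ℝ (GRW.Fib (n - 1))) (ℝ × M),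
        ∀ p ∈ e.source ∩ J ×ˢ (univ : Set M),
          ((n : ℝ) + 2) * GRW.dot (GRW.ricciEigenvalue a gs e) p
            = 2 * GRW.dot (GRW.scalarR a gs e) p) ∧
    -- the scalar curvature and the eigenvalue in the comoving frame
    (GRW.InGrayI (GRW.stBasis (n - 1)) (GRW.stModel (n - 1)) (GRW.grwMetric a gs)
        (J ×ˢ (univ : Set M)) →
      ∃ α β : ℝ, ∀ e ∈ atlas (ModelProd ℝ (GRW.Fib (n - 1))) (ℝ × M),
        ∀ t ∈ J, ∀ x : M, (t, x) ∈ e.source →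
          GRW.scalarR a gs e (t, x) = α - β * (((n : ℝ) + 2) / ((n : ℝ) - 2)) * a t ^ 2 ∧
          GRW.ricciEigenvalue a gs e (t, x)
            = α / n - β * (2 / ((n : ℝ) - 2)) * a t ^ 2) := by
  refine ⟨fun e he p hp w => ?_, GRW.grw_inGrayI_iff gs hJopen ha hapos (by omega)
    (by rw [Nat.cast_sub (by omega)]; simp) hJint hanc⟩
  obtain ⟨e', he', rfl⟩ := GRW.exists_eq_prod_of_mem_atlas he
  exact GRW.ricciTensor_comoving gs hJopen ha hapos he' hp.2.1 hp.1.2 w
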